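/- Let $V$ be a finite nonempty set, $\mathcal P(V)$ its power set, $\mathcal P_2(V)$ the set of ordered pairs of disjoint subsets of $V$, and $\vec 1_A\in\mathbb R^V$ the indicator vector of $A$. For $f:\mathcal P(V)\to\mathbb R$ the (original) Lovász extension is $$f^L(x)=\int_{\min x}^{\max x} f(\{i:x_i>t\})\,dt+f(V)\min x ,$$ and for $f:\mathcal P_2(V)\to\mathbb R$ the disjoint-pair Lovász extension is $$f^L(x)=\int_0^{\|x\|_\infty} f(\{i:x_i>t\},\{i:-x_i>t\})\,dt .$$ Let $\nabla F(x)=\{u:\limsup_{y\to x,\,t\to0^+}\frac{F(y+th)-F(y)}{t}\ge\langle u,h\rangle\ \forall h\}$ be the Clarke subgradient. A real $\lambda$ is an eigenvalue of $(F,G)$ with eigenvector $x\ne0$ if $0\in\nabla F(x)-\lambda\nabla G(x)$. **(1) Original extension.** Let $f,g:\mathcal P(V)\to\mathbb R$ and let $\lambda$ be an eigenvalue of $(f^L,g^L)$. Then there is $A\ne\varnothing$ with $f(A)=\lambda g(A)$ such that $\vec 1_A$ is an eigenvector for $\lambda$; and for any real $a\ne b$ there is an eigenvector for $\lambda$ in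 $\{a,b\}^V$. If $g(V)\neq0$, then $\lambda=f(V)/g(V)$; if $g(V)=0$, then $f(V)=0$. In the case $f(V)=g(V)=0$ there may be many eigenvalues: for every $k$ there are a finite set $V$ and $f,g$ with $f(V)=g(V)=0$ and $g(A)>0$ for $A\ne\varnothing,V$ such that $(f^L,g^L)$ has at least $k$ distinct eigenvalues with non-constant eigenvectors. **(2) Disjoint-pair extension.** Let $f,g:\mathcal P_2(V)\to\mathbb R$ and let $\lambda$ be an eigenvalue of $(f^L,g^L)$. Then there is $(A,B)\in\mathcal P_2(V)\setminus\{(\varnothing,\varnothing)\}$ with $f(A,B)=\lambda g(A,B)$ such that $\vec 1_A-\vec 1_B$ is an eigenvector for $\lambda$. If moreover $2f(A,B)=f(A,V\setminus A)+f(V\setminus B,B)$ and $2g(A,B)=g(A,V\setminus A)+g(V\setminus B,B)$ for all $(A,B)\in\mathcal P_2(V)\setminus\{(\varnothing,\varnothing)\}$, then there is $A\subset V$ with $f(A,V\setminus A)=\lambda g(A,V\setminus A)$ such that $\vec 1_A-\vec 1_{V\setminus A}$ is an eigenvector for $\lambda$. **(3)** Let $f,g:\mathcal P_2(V)\to\mathbb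 R$. If $f\ge0$ and $g$ equals a nonzero constant on $\mathcal P_2(V)\setminus\{(\varnothing,\varnothing)\}$, then for every $A\subset V$ the vector $\vec 1_A-\vec 1_{V\setminus A}$ is an eigenvector of $(f^L,g^L)$. **(4)** Let $\#V\ge2$, let $\hat f:\mathcal P(V)\to\mathbb R$ be symmetric ($\hat f(A)=\hat f(V\setminus A)$) with $\hat f(\varnothing)=0$, and let $\hat g:\mathcal P(V)\to[0,\infty)$ be non-decreasing and submodular with $\hat g(\varnothing)=0$ and $\hat g(A)>0$ for $A\neq\varnothing$. Put $f(A,B)=\hat f(A)+\hat f(B)$ and $g(A,B)=\hat g(A)+\hat g(B)$ on $\mathcal P_2(V)$. Then for $0\ne x\perp\vec 1$ the minimum $\min_t g^L(x-t\vec 1)$ is attained and positive, and (all minima being attained) $$\min_{0\ne x\perp\vec 1}\frac{f^L(x)}{\min_{t\in\mathbb R}g^L(x-t\vec 1)}=\min_{A\ne\varnothing,V}\frac{\hat f(A)}{\min\{\hat g(A),\hat g(V\setminus A)\}}=:\mathrm{Ch}.$$ If in addition $\hat f\ge0$, then also $$\mathrm{Ch}=\min_{A,B\ne\varnothing,\;A\cap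 B=\varnothing}\max\Big\{\frac{\hat f(A)}{\hat g(A)},\frac{\hat f(B)}{\hat g(B)}\Big\},$$ and $\mathrm{Ch}$ is the second eigenvalue of $(f^L,g^L)$, in each of the following senses: (i) it is the second smallest eigenvalue counted with multiplicity, that is, the least eigenvalue $\lambda$ such that the eigenvectors of eigenvalues $\le\lambda$ span a space of dimension at least $2$; (ii) the same with only the eigenvectors of the form $\vec 1_A-\vec 1_B$, $(A,B)\in\mathcal P_2(V)\setminus\{(\varnothing,\varnothing)\}$ (the combinatorial eigenvalue problem of $(f,g)$); (iii) it is the variational eigenvalue $\inf_S\sup_{x\in S} f^L(x)/g^L(x)$, where $S$ runs over the compact symmetric subsets of $\mathbb R^V\setminus\{0\}$ of Krasnoselskii genus at least $2$. -/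

import Mathlib

open scoped Pointwise Topology

noncomputable section

/-- `P₂(V)`: ordered pairs of disjoint subsets of `V`. -/
abbrev DisjointPair (V : Type*) := {p : Finset V × Finset V // Disjoint p.1 p.2}

section LovaszExtensions

variable {V : Type*} [Fintype V] [DecidableEq V]

/-- The empty pair `(∅, ∅)`. -/
def emptyPair : DisjointPair V := ⟨(∅, ∅), Finset.disjoint_empty_left ∅⟩

/-- The pair `(A, V \ A)`. -/
def pairLeft (A : Finset V) : DisjointPair V := ⟨(A, Aᶜ), disjoint_compl_right⟩

/-- The pair `(V \ B, B)`. -/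
def pairRight (B : Finset V) : DisjointPair V := ⟨(Bᶜ, B), disjoint_compl_left⟩

/-- The indicator vector `1_A`. -/
def indVec (A : Finset V) : V → ℝ := fun i => if i ∈ A then 1 else 0

/-- The vector `1_A - 1_B` of a disjoint pair `(A, B)`. -/
def pairVec (p : DisjointPair V) : V → ℝ := indVec p.1.1 - indVec p.1.2

/-- The upper level set `{i : x i > t}`. -/
def upperLevel (x : V → ℝ) (t : ℝ) : Finset V := {i | t < x i}

/-- The pair of level sets `({i : x i > t}, {i : -x i > t})` for `t ≥ 0`. (For `t < 0` these sets
need not be disjoint; the value at `t = 0` is used then. Only `t ≥ 0` enters below.) -/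
def levelPair (x : V → ℝ) (t : ℝ) : DisjointPair V :=
  ⟨(upperLevel x (max t 0), upperLevel (-x) (max t 0)), by
    refine Finset.disjoint_left.2 fun i hi hj => ?_
    simp only [upperLevel, Finset.mem_filter, Finset.mem_univ, true_and, Pi.neg_apply] at hi hj
    have := le_max_right t 0
    linarith⟩

/-- The original Lovász extension
`f^L(x) = ∫_{min x}^{max x} f({i : x i > t}) dt + f(V) min x`. -/
def lovaszExt (f : Finset V → ℝ) (x : V → ℝ) : ℝ :=
  (∫ t in (⨅ i, x i)..(⨆ i, x i), f (upperLevel x t)) + f Finset.univ * ⨅ i, x i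

/-- The disjoint-pair Lovász extension
`f^L(x) = ∫_0^{‖x‖_∞} f({i : x i > t}, {i : -x i > t}) dt`; the norm of `V → ℝ` is the
maximum norm. -/
def pairLovaszExt (f : DisjointPair V → ℝ) (x : V → ℝ) : ℝ :=
  ∫ t in (0 : ℝ)..‖x‖, f (levelPair x t)

/-- The function `(A, B) ↦ f(A) + f(B)` on disjoint pairs. -/
def pairSum (f : Finset V → ℝ) : DisjointPair V → ℝ := fun p => f p.1.1 + f p.1.2

/-- Submodularity of a set function. -/
def IsSubmodular (f : Finset V → ℝ) : Prop :=
  ∀ A B : Finset V, f (A ∪ B) + f (A ∩ B) ≤ f A + f B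

/-- The condition `2 f(A,B) = f(A, V \ A) + f(V \ B, B)` for all `(A,B) ≠ (∅,∅)`. -/
def SplitsEvenly (f : DisjointPair V → ℝ) : Prop :=
  ∀ p : DisjointPair V, p ≠ emptyPair → 2 * f p = f (pairLeft p.1.1) + f (pairRight p.1.2)

end LovaszExtensions

section Eigenvalues

variable {V : Type*} [Fintype V]

/-- The Clarke subdifferential of `F` at `x`: all `u` with
`limsup_{y → x, t → 0⁺} (F(y + t h) - F(y)) / t ≥ ⟨u, h⟩` for all `h`.
The `limsup` is taken in the extended reals. -/
def clarkeSubdiff (F : (V → ℝ) → ℝ) (x : V → ℝ) : Set (V → ℝ) :=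
  {u | ∀ h : V → ℝ, ((u ⬝ᵥ h : ℝ) : EReal) ≤
    Filter.limsup (fun q : (V → ℝ) × ℝ => (((F (q.1 + q.2 • h) - F q.1) / q.2 : ℝ) : EReal))
      (𝓝 x ×ˢ 𝓝[>] (0 : ℝ))}

/-- `(lam, x)` is an eigenpair of `(F, G)`: `x ≠ 0` and `0 ∈ ∇F(x) - lam ∇G(x)`. -/
def IsEigenpair (F G : (V → ℝ) → ℝ) (lam : ℝ) (x : V → ℝ) : Prop :=
  x ≠ 0 ∧ (0 : V → ℝ) ∈ clarkeSubdiff F x - lam • clarkeSubdiff G x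

/-- `lam` is an eigenvalue of `(F, G)`. -/
def IsEigenvalue (F G : (V → ℝ) → ℝ) (lam : ℝ) : Prop := ∃ x, IsEigenpair F G lam x

/-- `mu` is the `k`-th smallest eigenvalue of `(F, G)` counted with multiplicity: the least
eigenvalue such that the eigenvectors of eigenvalues up to it span at least `k` dimensions. -/
def IsKthEigenvalue (F G : (V → ℝ) → ℝ) (k : ℕ) (mu : ℝ) : Prop :=
  IsLeast {lam : ℝ | IsEigenvalue F G lam ∧
    k ≤ Module.finrank ℝ (Submodule.span ℝ {x | ∃ nu ≤ lam, IsEigenpair F G nu x})} mu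

/-- The Krasnoselskii genus of the symmetric set `S` is at least `m`: for no `k < m` is there an
odd continuous map from `S` to `ℝᵏ \ {0}`. -/
def GenusAtLeast (S : Set (V → ℝ)) (m : ℕ) : Prop :=
  ∀ k < m, ¬ ∃ φ : S → (Fin k → ℝ), Continuous φ ∧ (∀ x, φ x ≠ 0) ∧
    ∀ x y : S, (y : V → ℝ) = -(x : V → ℝ) → φ y = -φ x

/-- `mu` is the `m`-th variational (min-max) eigenvalue `inf_S sup_{x ∈ S} F(x) / G(x)`, where `S`
runs over the compact symmetric sets of nonzero vectors of Krasnoselskii genus at least `m`. -/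
def IsMinmaxEigenvalue (F G : (V → ℝ) → ℝ) (m : ℕ) (mu : ℝ) : Prop :=
  IsGLB {s : ℝ | ∃ S : Set (V → ℝ), IsCompact S ∧ (0 : V → ℝ) ∉ S ∧ (∀ x ∈ S, -x ∈ S) ∧
    GenusAtLeast S m ∧ IsLUB ((fun x => F x / G x) '' S) s} mu

end Eigenvalues

section Eigensets

variable {V : Type*} [Fintype V] [DecidableEq V]

/-- `p = (A, B) ≠ (∅, ∅)` is an eigenset of `(f, g)` with eigenvalue `lam`, where the subgradient of
a function on disjoint pairs is `∇f(A, B) = ∇f^L(1_A - 1_B)`. -/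
def IsEigenset (f g : DisjointPair V → ℝ) (lam : ℝ) (p : DisjointPair V) : Prop :=
  p ≠ emptyPair ∧ IsEigenpair (pairLovaszExt f) (pairLovaszExt g) lam (pairVec p)

/-- `mu` is the `k`-th smallest eigenvalue of the combinatorial eigenvalue problem of `(f, g)`,
counted with multiplicity. -/
def IsKthSetEigenvalue (f g : DisjointPair V → ℝ) (k : ℕ) (mu : ℝ) : Prop :=
  IsLeast {lam : ℝ | (∃ p, IsEigenset f g lam p) ∧
    k ≤ Module.finrank ℝ
      (Submodule.span ℝ {x | ∃ nu ≤ lam, ∃ p, IsEigenset f g nu p ∧ x = pairVec p})} mu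

end Eigensets

end

/-!
The proof rests on one property of a Lovász extension `F`. Near a vector `x`, adding a positive
multiple of the vector of a level set (or level pair) of `x` only inserts one more level, so `F` is
linear in that direction from every point near `x`, with slope the value `κ` of the set function
(`IsLinearAlong`). If `F` is also positively homogeneous, its difference quotients near `x`
reappear, after scaling, near the level vector `x'`. Hence the Clarke subdifferential at `x` is
contained in the one at `x'`, and all its elements `u` satisfy `⟨u, x'⟩ = κ`. So an eigenvector can
be replaced by each of its level vectors with the same eigenvalue, and the eigenvalue is the
quotient of the values of the set functions. For the original extension the constant vectors always
qualify (`lovaszExt_add_const`); for the disjoint-pair extension the level pairs do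
(`FitsAt.pairLovaszExt_add`), and for evenly splitting functions so do the vectors
`1_A - 1_{V \ A}` of suitable upper level sets (`IsSignedUpperSet.pairLovaszExt_add`).

Many eigenvalues of the original extension come from a cycle: `f` adds up the positions at which `A`
starts along the cycle and `g` is the indicator of the nonempty proper sets. Near a vector with one
ascent, at `i`, both extensions are linear and the first is `i` times the second
(`isEigenpair_weightedCut`).

If `g` is constant, the Clarke subdifferential of `g^L` at a sign vector contains every convex
combination of the signed basis vectors, up to the constant. The subdifferential of `f^L` contains
the gradients along all maximal chains of level pairs. If `f ≥ 0`, the convex hull of these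
gradients meets the orthant of the sign vector, since a separating functional would contradict
`f ≥ 0` on its own level pairs (`exists_mem_convexHull_chainGradient`).

For sums `f(A) + f(B)` and `g(A) + g(B)` the argument turns on balanced vectors, those having zero
as a median with respect to `g`, and on the isoperimetric constant `c`, the least value of
`f(A) / min {g(A), g(V \ A)}`. Every vector has a balanced translate, which minimises `g^L` among the
translates. The level sets of a balanced vector are the lighter sides of their cuts, so on them the
isoperimetric inequality reads `c g ≤ f`, and it integrates to `c g^L ≤ f^L`
(`IsBalancedVec.mul_pairSum_le`). As `f^L` is invariant under translations, this gives the quotient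
formula. An eigenvector with nonzero eigenvalue is balanced, because its subgradient of `g^L` is
orthogonal to the constants; hence the eigenvectors with eigenvalue below `c` are constant
(`IsEigenpair.eq_const_of_lt`). In the other direction, if `A` is the lighter side of an optimal
cut, a combination of two greedy vectors of `g` is a subgradient `v` of `g^L` at `1_A` orthogonal to
the constants, and `c v` is the slope of a linear minorant of `f^L` that touches it at `1_A`
(`isEigenpair_indVec`). For the variational eigenvalue, the sign of the median is an odd continuous
function on a set without balanced vectors, so a set of genus two contains a balanced vector; the
circle in the plane spanned by `1_A` and `1_{V \ A}` attains the bound.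
-/

/-! ### Clarke subdifferentials and directions of linearity -/

section ClarkeCalculus

open Filter

variable {V : Type*} [Fintype V] {F G : (V → ℝ) → ℝ} {x x' u : V → ℝ} {κ : ℝ}

theorem mem_clarkeSubdiff_of_frequently
    (H : ∀ h : V → ℝ, ∃ᶠ q : (V → ℝ) × ℝ in 𝓝 x ×ˢ 𝓝[>] (0 : ℝ),
      u ⬝ᵥ h ≤ (F (q.1 + q.2 • h) - F q.1) / q.2) :
    u ∈ clarkeSubdiff F x := fun h =>
  le_limsup_of_frequently_le ((H h).mono fun _ hq => by exact_mod_cast hq)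

/-- A global affine minorant that touches `F` at `x` gives a Clarke subgradient, whether or not `F`
is convex. -/
theorem mem_clarkeSubdiff_of_minorant (H : ∀ y, F x + u ⬝ᵥ (y - x) ≤ F y) :
    u ∈ clarkeSubdiff F x := by
  refine mem_clarkeSubdiff_of_frequently fun h => ?_
  have ht : Tendsto (fun t : ℝ => (x, t)) (𝓝[>] 0) (𝓝 x ×ˢ 𝓝[>] (0 : ℝ)) :=
    tendsto_const_nhds.prodMk tendsto_id
  refine ht.frequently (Eventually.frequently ?_)
  filter_upwards [self_mem_nhdsWithin] with t ht
  have := H (x + t • h)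
  rw [add_sub_cancel_left, dotProduct_smul, smul_eq_mul] at this
  rw [le_div_iff₀ ht]
  linarith

theorem mem_clarkeSubdiff_of_eventuallyEq (H : ∀ᶠ y in 𝓝 x, F y = u ⬝ᵥ y) :
    u ∈ clarkeSubdiff F x := by
  refine mem_clarkeSubdiff_of_frequently fun h => ?_
  have ht : Tendsto (fun t : ℝ => (x, t)) (𝓝[>] 0) (𝓝 x ×ˢ 𝓝[>] (0 : ℝ)) :=
    tendsto_const_nhds.prodMk tendsto_id
  refine ht.frequently (Eventually.frequently ?_)
  have hc : Tendsto (fun t : ℝ => x + t • h) (𝓝[>] 0) (𝓝 x) := by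
    have : Continuous fun t : ℝ => x + t • h := by fun_prop
    simpa using (this.tendsto 0).mono_left nhdsWithin_le_nhds
  filter_upwards [self_mem_nhdsWithin, hc.eventually H] with t ht h1
  rw [le_div_iff₀ ht, h1, H.self_of_nhds, dotProduct_add, dotProduct_smul, smul_eq_mul]
  linarith

theorem dotProduct_le_of_mem_clarkeSubdiff (hu : u ∈ clarkeSubdiff F x) {h : V → ℝ} {C : ℝ}
    (H : ∀ᶠ q : (V → ℝ) × ℝ in 𝓝 x ×ˢ 𝓝[>] (0 : ℝ),
      F (q.1 + q.2 • h) - F q.1 ≤ q.2 * C) : u ⬝ᵥ h ≤ C := by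
  have h1 := hu h
  have h2 : limsup (fun q : (V → ℝ) × ℝ => (((F (q.1 + q.2 • h) - F q.1) / q.2 : ℝ) : EReal))
      (𝓝 x ×ˢ 𝓝[>] (0 : ℝ)) ≤ (C : EReal) := by
    refine limsup_le_of_le (by isBoundedDefault) ?_
    filter_upwards [H, tendsto_snd.eventually self_mem_nhdsWithin] with q hq hpos
    have hpos : 0 < q.2 := hpos
    rw [EReal.coe_le_coe_iff, div_le_iff₀ hpos]
    linarith
  exact_mod_cast h1.trans h2

theorem convex_clarkeSubdiff : Convex ℝ (clarkeSubdiff F x) := by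
  intro u hu v hv a b ha hb hab h
  have key : (a • u + b • v) ⬝ᵥ h ≤ max (u ⬝ᵥ h) (v ⬝ᵥ h) := by
    rw [add_dotProduct, smul_dotProduct, smul_dotProduct, smul_eq_mul, smul_eq_mul]
    have h1 := mul_le_mul_of_nonneg_left (le_max_left (u ⬝ᵥ h) (v ⬝ᵥ h)) ha
    have h2 := mul_le_mul_of_nonneg_left (le_max_right (u ⬝ᵥ h) (v ⬝ᵥ h)) hb
    calc _ ≤ (a + b) * max (u ⬝ᵥ h) (v ⬝ᵥ h) := by linarith
      _ = _ := by rw [hab, one_mul]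
  refine (EReal.coe_le_coe_iff.2 key).trans ?_
  rcases max_choice (u ⬝ᵥ h) (v ⬝ᵥ h) with e | e
  · rw [e]; exact hu h
  · rw [e]; exact hv h

/-- `F` grows linearly, with slope `κ`, in the direction `x'` from every point near `x`. For a
Lovász extension this holds when `x'` is the indicator vector of a level set of `x`. -/
def IsLinearAlong (F : (V → ℝ) → ℝ) (x x' : V → ℝ) (κ : ℝ) : Prop :=
  ∀ᶠ y in 𝓝 x, ∀ c : ℝ, 0 ≤ c → F (y + c • x') = F y + c * κ

/-- Positive homogeneity of degree one. -/
def PosHom (F : (V → ℝ) → ℝ) : Prop := ∀ (c : ℝ) (x : V → ℝ), 0 < c → F (c • x) = c * F x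

theorem IsLinearAlong.dotProduct_eq (h : IsLinearAlong F x x' κ) (hu : u ∈ clarkeSubdiff F x) :
    u ⬝ᵥ x' = κ := by
  have hpos : ∀ᶠ q : (V → ℝ) × ℝ in 𝓝 x ×ˢ 𝓝[>] (0 : ℝ), 0 < q.2 :=
    tendsto_snd.eventually self_mem_nhdsWithin
  apply le_antisymm
  · refine dotProduct_le_of_mem_clarkeSubdiff hu ?_
    filter_upwards [hpos, tendsto_fst.eventually h] with q hq h1
    rw [h1 _ hq.le]
    linarith
  · have hc : Tendsto (fun q : (V → ℝ) × ℝ => q.1 + q.2 • (-x')) (𝓝 x ×ˢ 𝓝[>] (0 : ℝ)) (𝓝 x) := by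
      have : Continuous fun q : (V → ℝ) × ℝ => q.1 + q.2 • (-x') := by fun_prop
      have h0 := this.tendsto (x, 0)
      rw [nhds_prod_eq] at h0
      simpa using h0.mono_left (Filter.prod_mono le_rfl nhdsWithin_le_nhds)
    have : u ⬝ᵥ (-x') ≤ -κ := by
      refine dotProduct_le_of_mem_clarkeSubdiff hu ?_
      filter_upwards [hpos, hc.eventually h] with q hq h1
      have h2 := h1 q.2 hq.le
      rw [show q.1 + q.2 • -x' + q.2 • x' = q.1 by simp] at h2
      linarith
    rw [dotProduct_neg] at this
    linarith

/-- The points `x' + ε y`, for `y` near `x` and `ε` small, are near `x'`, and the difference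
quotients of `F` there equal those at `y`. -/
theorem IsLinearAlong.clarkeSubdiff_subset (h : IsLinearAlong F x x' κ) (hF : PosHom F) :
    clarkeSubdiff F x ⊆ clarkeSubdiff F x' := by
  intro u hu d
  refine (hu d).trans ?_
  refine le_limsup_of_le (by isBoundedDefault) fun b hb => ?_
  refine limsup_le_of_le (by isBoundedDefault) ?_
  obtain ⟨pa, hpa, pb, hpb, hab⟩ := eventually_prod_iff.1 hb
  have hε : Tendsto (fun ε : ℝ => x' + ε • x) (𝓝[>] 0) (𝓝 x') := by
    have : Continuous fun ε : ℝ => x' + ε • x := by fun_prop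
    simpa using (this.tendsto 0).mono_left nhdsWithin_le_nhds
  obtain ⟨ε, hεp, hε0⟩ :=
    ((hε.eventually (eventually_eventually_nhds.2 hpa)).and self_mem_nhdsWithin).exists
  have hε0 : 0 < ε := hε0
  have e1 : Tendsto (fun q : (V → ℝ) × ℝ => x' + ε • q.1) (𝓝 x ×ˢ 𝓝[>] (0 : ℝ))
      (𝓝 (x' + ε • x)) :=
    tendsto_const_nhds.add (tendsto_fst.const_smul ε)
  have e2 : Tendsto (fun q : (V → ℝ) × ℝ => ε * q.2) (𝓝 x ×ˢ 𝓝[>] (0 : ℝ)) (𝓝[>] 0) := by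
    refine Tendsto.comp (y := 𝓝[>] 0) (g := fun t => ε * t) ?_ tendsto_snd
    refine tendsto_nhdsWithin_iff.2 ⟨?_, ?_⟩
    · have : Continuous fun t : ℝ => ε * t := by fun_prop
      simpa using (this.tendsto 0).mono_left nhdsWithin_le_nhds
    · filter_upwards [self_mem_nhdsWithin] with t ht using mul_pos hε0 ht
  have e3 : Tendsto (fun q : (V → ℝ) × ℝ => q.1 + q.2 • d) (𝓝 x ×ˢ 𝓝[>] (0 : ℝ)) (𝓝 x) := by
    have : Continuous fun q : (V → ℝ) × ℝ => q.1 + q.2 • d := by fun_prop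
    have h0 := this.tendsto (x, 0)
    rw [nhds_prod_eq] at h0
    simpa using h0.mono_left (Filter.prod_mono le_rfl nhdsWithin_le_nhds)
  have key : ∀ y : V → ℝ, (∀ c : ℝ, 0 ≤ c → F (y + c • x') = F y + c * κ) →
      F (x' + ε • y) = ε * F y + κ := by
    intro y hy
    have : x' + ε • y = ε • (y + ε⁻¹ • x') := by
      rw [smul_add, smul_smul, mul_inv_cancel₀ hε0.ne', one_smul, add_comm]
    rw [this, hF _ _ hε0, hy _ (inv_nonneg.2 hε0.le)]
    field_simp
  filter_upwards [e1.eventually hεp, e2.eventually hpb, tendsto_fst.eventually h,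
    e3.eventually h, tendsto_snd.eventually self_mem_nhdsWithin] with q h1 h2 h3 h4 h5
  have h5 : 0 < q.2 := h5
  have := hab h1 h2
  simp only at this
  rw [show x' + ε • q.1 + (ε * q.2) • d = x' + ε • (q.1 + q.2 • d) by
    rw [smul_add, smul_smul, add_assoc], key _ h3, key _ h4] at this
  rwa [add_sub_add_right_eq_sub, ← mul_sub, mul_div_mul_left _ _ hε0.ne'] at this

theorem IsEigenpair.dotProduct_eq {lam κ' : ℝ} (h : IsEigenpair F G lam x)
    (hF : IsLinearAlong F x x' κ) (hG : IsLinearAlong G x x' κ') : κ = lam * κ' := by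
  obtain ⟨-, u, hu, w, ⟨v, hv, rfl⟩, huv⟩ := h
  have huv : u = lam • v := sub_eq_zero.1 huv
  rw [← hF.dotProduct_eq hu, ← hG.dotProduct_eq hv, huv, smul_dotProduct, smul_eq_mul]

theorem IsEigenpair.of_isLinearAlong {lam κ' : ℝ} (h : IsEigenpair F G lam x) (hx' : x' ≠ 0)
    (hFh : PosHom F) (hGh : PosHom G)
    (hF : IsLinearAlong F x x' κ) (hG : IsLinearAlong G x x' κ') : IsEigenpair F G lam x' :=
  ⟨hx', Set.sub_subset_sub (hF.clarkeSubdiff_subset hFh)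
    (Set.smul_set_mono (hG.clarkeSubdiff_subset hGh)) h.2⟩

theorem isEigenpair_of_mem {lam : ℝ} (hx : x ≠ 0) {v : V → ℝ} (hu : lam • v ∈ clarkeSubdiff F x)
    (hv : v ∈ clarkeSubdiff G x) : IsEigenpair F G lam x :=
  ⟨hx, lam • v, hu, lam • v, ⟨v, hv, rfl⟩, sub_self _⟩

end ClarkeCalculus

/-! ### Level sets and their integrals -/

section LevelSets

open Filter MeasureTheory

variable {V : Type*} [Fintype V]

theorem exists_abs_eq_norm [Nonempty V] (x : V → ℝ) : ∃ i, |x i| = ‖x‖ := by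
  obtain ⟨i, hi⟩ := Finite.exists_max fun i => |x i|
  refine ⟨i, le_antisymm (norm_le_pi_norm x i) ?_⟩
  exact (pi_norm_le_iff_of_nonneg (abs_nonneg _)).2 hi

theorem abs_apply_le_norm (x : V → ℝ) (i : V) : |x i| ≤ ‖x‖ := norm_le_pi_norm x i

@[simp] theorem mem_upperLevel {x : V → ℝ} {t : ℝ} {i : V} : i ∈ upperLevel x t ↔ t < x i := by
  simp [upperLevel]

variable [DecidableEq V]

theorem measurableSet_upperLevel_eq (x : V → ℝ) (A : Finset V) :
    MeasurableSet {t : ℝ | upperLevel x t = A} := by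
  have : {t : ℝ | upperLevel x t = A} = ⋂ i, {t : ℝ | t < x i ↔ i ∈ A} := by
    ext t
    simp [Finset.ext_iff]
  rw [this]
  refine MeasurableSet.iInter fun i => ?_
  by_cases hi : i ∈ A
  · simp only [hi, iff_true]
    exact measurableSet_Iio
  · simp only [hi, iff_false, not_lt]
    exact measurableSet_Ici

/-- A function of finitely many values with measurable fibres is integrable on intervals. -/
theorem intervalIntegrable_of_fibres {α : Type*} [Finite α] {ψ : ℝ → α}
    (hψ : ∀ p, MeasurableSet {t | ψ t = p}) (f : α → ℝ) (a b : ℝ) :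
    IntervalIntegrable (fun t => f (ψ t)) volume a b := by
  let _ : MeasurableSpace α := ⊤
  have hm : Measurable fun t => f (ψ t) :=
    measurable_from_top.comp (measurable_to_countable' hψ)
  obtain ⟨C, hC⟩ := (Set.finite_range fun p => ‖f p‖).bddAbove
  have : IsFiniteMeasure (volume.restrict (Set.uIoc a b)) := by
    unfold Set.uIoc; infer_instance
  exact intervalIntegrable_iff.2 (Integrable.of_bound hm.aestronglyMeasurable C
    (Eventually.of_forall fun t => hC ⟨ψ t, rfl⟩))

theorem intervalIntegrable_upperLevel (φ : Finset V → ℝ) (x : V → ℝ) (a b : ℝ) :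
    IntervalIntegrable (fun t => φ (upperLevel x t)) volume a b :=
  intervalIntegrable_of_fibres (measurableSet_upperLevel_eq x) φ a b

theorem intervalIntegrable_levelPair (f : DisjointPair V → ℝ) (x : V → ℝ) (a b : ℝ) :
    IntervalIntegrable (fun t => f (levelPair x t)) volume a b := by
  refine intervalIntegrable_of_fibres (fun p => ?_) f a b
  have hmax : Measurable fun t : ℝ => max t 0 := by fun_prop
  have : {t : ℝ | levelPair x t = p} =
      (fun t : ℝ => max t 0) ⁻¹' {t | upperLevel x t = p.1.1} ∩
        (fun t : ℝ => max t 0) ⁻¹' {t | upperLevel (-x) t = p.1.2} := by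
    ext t
    simp [levelPair, Subtype.ext_iff, Prod.ext_iff]
  rw [this]
  exact (hmax (measurableSet_upperLevel_eq _ _)).inter (hmax (measurableSet_upperLevel_eq _ _))

/-- Integrals are compared through the interior of the interval, where the levels are strict. -/
theorem integral_congr_Ioo {f g : ℝ → ℝ} {a b : ℝ} (hab : a ≤ b)
    (h : ∀ t, a < t → t < b → f t = g t) : ∫ t in a..b, f t = ∫ t in a..b, g t := by
  rw [intervalIntegral.integral_of_le hab, intervalIntegral.integral_of_le hab,
    integral_Ioc_eq_integral_Ioo, integral_Ioc_eq_integral_Ioo]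
  exact setIntegral_congr_fun measurableSet_Ioo fun t ht => h t ht.1 ht.2

theorem integral_const_Ioo {f : ℝ → ℝ} {a b k : ℝ} (hab : a ≤ b)
    (h : ∀ t, a < t → t < b → f t = k) : ∫ t in a..b, f t = (b - a) * k := by
  rw [integral_congr_Ioo hab h, intervalIntegral.integral_const, smul_eq_mul]

end LevelSets

/-! ### The original Lovász extension -/

section OriginalExtension

open Filter MeasureTheory

variable {V : Type*} [Fintype V] [DecidableEq V]

omit [DecidableEq V] in
theorem posHom_lovaszExt (f : Finset V → ℝ) : PosHom (lovaszExt f) := by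
  intro c x hc
  have h1 : ⨅ i, (c • x) i = c * ⨅ i, x i := (Real.mul_iInf_of_nonneg hc.le _).symm
  have h2 : ⨆ i, (c • x) i = c * ⨆ i, x i := (Real.mul_iSup_of_nonneg hc.le _).symm
  have h3 : ∀ t, upperLevel (c • x) (c * t) = upperLevel x t := by
    intro t; ext i; simp [mul_lt_mul_iff_right₀ hc]
  have h4 := intervalIntegral.mul_integral_comp_mul_left (a := ⨅ i, x i) (b := ⨆ i, x i)
    (f := fun t => f (upperLevel (c • x) t)) c
  simp only [h3] at h4
  rw [lovaszExt, h1, h2, ← h4, lovaszExt]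
  ring

omit [DecidableEq V] in
theorem lovaszExt_add_const [Nonempty V] (f : Finset V → ℝ) (x : V → ℝ) (c : ℝ) :
    lovaszExt f (x + fun _ => c) = lovaszExt f x + c * f Finset.univ := by
  have h1 : ⨅ i, (x + fun _ => c : V → ℝ) i = (⨅ i, x i) + c :=
    (ciInf_add (Set.finite_range x).bddBelow c).symm
  have h2 : ⨆ i, (x + fun _ => c : V → ℝ) i = (⨆ i, x i) + c :=
    (ciSup_add (Set.finite_range x).bddAbove c).symm
  have h3 : ∀ t, upperLevel (x + fun _ => c) (t + c) = upperLevel x t := by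
    intro t; ext i; simp
  have h4 := intervalIntegral.integral_comp_add_right (a := ⨅ i, x i) (b := ⨆ i, x i)
    (fun t => f (upperLevel (x + fun _ => c) t)) c
  simp only [h3] at h4
  rw [lovaszExt, h1, h2, ← h4, lovaszExt]
  ring

omit [DecidableEq V] in
theorem isLinearAlong_lovaszExt_const [Nonempty V] (f : Finset V → ℝ) (x : V → ℝ) (a : ℝ) :
    IsLinearAlong (lovaszExt f) x (fun _ => a) (a * f Finset.univ) := by
  refine Eventually.of_forall fun y c _ => ?_
  have := lovaszExt_add_const f y (c * a)
  rw [← mul_assoc, ← this]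
  rfl

/-- The sum of the positions `i` on the cycle `ℤ/n` with `i ∈ A` and `i - 1 ∉ A`. -/
def weightedCut (n : ℕ) [NeZero n] (A : Finset (Fin n)) : ℝ :=
  ∑ i : Fin n, if i ∈ A ∧ i - 1 ∉ A then (i : ℝ) else 0

/-- The indicator of the nonempty proper subsets. -/
def properIndicator (n : ℕ) (A : Finset (Fin n)) : ℝ :=
  if A ≠ ∅ ∧ A ≠ Finset.univ then 1 else 0

/-- The vector on the cycle `ℤ/n` that descends by unit steps from position `i` on. -/
def descent (n : ℕ) [NeZero n] (i : Fin n) : Fin n → ℝ := fun j => -((j - i : Fin n) : ℕ)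

/-- The vectors whose only ascent along the cycle is the step into `i`. -/
def HasUniqueAscent {n : ℕ} [NeZero n] (i : Fin n) (y : Fin n → ℝ) : Prop :=
  y (i - 1) < y i ∧ ∀ j, j ≠ i → y j < y (j - 1)

theorem eventually_hasUniqueAscent {n : ℕ} [NeZero n] {i : Fin n} {x : Fin n → ℝ}
    (h : HasUniqueAscent i x) : ∀ᶠ y in 𝓝 x, HasUniqueAscent i y := by
  refine (IsOpen.eventually_mem (isOpen_lt (f := fun y : Fin n → ℝ => y (i - 1))
    (g := fun y => y i) (by fun_prop) (by fun_prop)) h.1).and ?_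
  refine eventually_all.2 fun j => ?_
  by_cases hj : j = i
  · exact Eventually.of_forall fun _ h => absurd hj h
  · filter_upwards [IsOpen.eventually_mem (isOpen_lt (f := fun y : Fin n → ℝ => y j)
      (g := fun y => y (j - 1)) (by fun_prop) (by fun_prop)) (h.2 j hj)] with y hy _ using hy

theorem hasUniqueAscent_descent (m : ℕ) (i : Fin (m + 2)) :
    HasUniqueAscent i (descent (m + 2) i) := by
  constructor
  · have : (0 : ℝ) ≤ m := m.cast_nonneg
    simp [descent]
    linarith
  · intro j hj
    have h0 : j - i ≠ 0 := sub_ne_zero.2 hj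
    have h1 : j - 1 - i = (j - i) - 1 := by abel
    have h2 : 0 < ((j - i : Fin (m + 2)) : ℕ) := Nat.pos_of_ne_zero fun h => h0 (Fin.ext h)
    simp only [descent, h1, Fin.val_sub_one_of_ne_zero h0]
    rw [neg_lt_neg_iff, Nat.cast_lt]
    omega

open Fin.CommRing in
/-- Going down the cycle from `i`, the entries decrease until position `i - 1` is reached. -/
theorem HasUniqueAscent.le_apply {m : ℕ} {i : Fin (m + 2)} {y : Fin (m + 2) → ℝ}
    (h : HasUniqueAscent i y) (j : Fin (m + 2)) : y j ≤ y i ∧ y (i - 1) ≤ y j := by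
  have key : ∀ k : ℕ, k < m + 2 → y (i + (k : Fin (m + 2))) ≤ y i ∧
      y (i - 1) ≤ y (i - 1 - (k : Fin (m + 2))) := by
    intro k
    induction k with
    | zero => intro _; simp
    | succ k ih =>
      intro hk
      obtain ⟨h1, h2⟩ := ih (by omega)
      have h0 : ((k + 1 : ℕ) : Fin (m + 2)) ≠ 0 := by
        intro h0
        have := congrArg Fin.val h0
        rw [Fin.val_natCast, Nat.mod_eq_of_lt hk] at this
        simp at this
      constructor
      · have h3 := h.2 (i + ((k + 1 : ℕ) : Fin (m + 2))) (by simpa using h0)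
        rw [show i + ((k + 1 : ℕ) : Fin (m + 2)) - 1 = i + (k : Fin (m + 2)) by
          push_cast; abel] at h3
        linarith
      · have h3 := h.2 (i - 1 - (k : Fin (m + 2))) (by
          intro h3
          apply h0
          push_cast
          calc (k : Fin (m + 2)) + 1 = i - (i - 1 - k) := by abel
            _ = 0 := by rw [h3, sub_self])
        rw [show i - 1 - ((k + 1 : ℕ) : Fin (m + 2)) = i - 1 - (k : Fin (m + 2)) - 1 by
          push_cast; abel]
        linarith
  constructor
  · have := (key (j - i : Fin (m + 2)) (Fin.is_lt _)).1
    rwa [Fin.cast_val_eq_self, add_sub_cancel] at this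
  · have := (key (i - 1 - j : Fin (m + 2)) (Fin.is_lt _)).2
    rwa [Fin.cast_val_eq_self, sub_sub_cancel] at this

theorem HasUniqueAscent.lovaszExt_eq {m : ℕ} {i : Fin (m + 2)} {y : Fin (m + 2) → ℝ}
    (h : HasUniqueAscent i y) {f : Finset (Fin (m + 2)) → ℝ} {κ : ℝ} (hf : f Finset.univ = 0)
    (hκ : ∀ A, i ∈ A → i - 1 ∉ A → (∀ j ∈ A, j ≠ i → j - 1 ∈ A) → f A = κ) :
    lovaszExt f y = κ * (y i - y (i - 1)) := by
  have h1 : ⨅ j, y j = y (i - 1) :=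
    le_antisymm (ciInf_le (Set.finite_range y).bddBelow _) (le_ciInf fun j => (h.le_apply j).2)
  have h2 : ⨆ j, y j = y i :=
    le_antisymm (ciSup_le fun j => (h.le_apply j).1) (le_ciSup (Set.finite_range y).bddAbove _)
  rw [lovaszExt, h1, h2, hf, zero_mul, add_zero, integral_const_Ioo h.1.le, mul_comm]
  intro t ht1 ht2
  refine hκ _ (by simpa using ht2) (by simpa using ht1.le) fun j hj hji => ?_
  rw [mem_upperLevel] at hj ⊢
  exact hj.trans (h.2 j hji)

/-- Near a vector with unique ascent at `i`, every level set starts at `i` only. There the extension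
of the weighted cut function is `i` times that of the indicator, and both are linear. -/
theorem isEigenpair_weightedCut (m : ℕ) (i : Fin (m + 2)) :
    IsEigenpair (lovaszExt (weightedCut (m + 2))) (lovaszExt (properIndicator (m + 2)))
      (i : ℝ) (descent (m + 2) i) := by
  have hd := hasUniqueAscent_descent m i
  have hne : i - 1 ≠ i := by simp
  have hv : ∀ y : Fin (m + 2) → ℝ,
      (Pi.single i 1 - Pi.single (i - 1) 1 : Fin (m + 2) → ℝ) ⬝ᵥ y = y i - y (i - 1) := by
    intro y; simp [sub_dotProduct]
  refine isEigenpair_of_mem (v := Pi.single i 1 - Pi.single (i - 1) 1) ?_ ?_ ?_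
  · intro h0
    have := hd.1
    rw [h0] at this
    simp at this
  · refine mem_clarkeSubdiff_of_eventuallyEq ?_
    filter_upwards [eventually_hasUniqueAscent hd] with y hy
    rw [smul_dotProduct, hv, smul_eq_mul]
    refine hy.lovaszExt_eq (by simp [weightedCut]) fun A h1 h2 h3 => ?_
    rw [weightedCut, Finset.sum_eq_single i]
    · simp [h1, h2]
    · intro j _ hj
      rw [if_neg]
      rintro ⟨h4, h5⟩
      exact h5 (h3 j h4 hj)
    · simp
  · refine mem_clarkeSubdiff_of_eventuallyEq ?_
    filter_upwards [eventually_hasUniqueAscent hd] with y hy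
    rw [hv, ← one_mul (y i - _)]
    refine hy.lovaszExt_eq (by simp [properIndicator]) fun A h1 h2 _ => ?_
    rw [properIndicator, if_pos]
    exact ⟨Finset.ne_empty_of_mem h1, fun h => h2 (h ▸ Finset.mem_univ _)⟩

theorem exists_many_eigenvalues (k : ℕ) :
    ∃ (n : ℕ) (f g : Finset (Fin n) → ℝ), f Finset.univ = 0 ∧ g Finset.univ = 0 ∧
      (∀ A : Finset (Fin n), A ≠ ∅ → A ≠ Finset.univ → 0 < g A) ∧
      (k : ℕ∞) ≤ {lam : ℝ | ∃ x : Fin n → ℝ, (∃ i j, x i ≠ x j) ∧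
        IsEigenpair (lovaszExt f) (lovaszExt g) lam x}.encard := by
  refine ⟨k + 2, weightedCut (k + 2), properIndicator (k + 2), by simp [weightedCut],
    by simp [properIndicator], fun A h1 h2 => by simp [properIndicator, h1, h2], ?_⟩
  have hsub : Set.range (fun i : Fin (k + 2) => ((i : ℕ) : ℝ)) ⊆
      {lam : ℝ | ∃ x : Fin (k + 2) → ℝ, (∃ i j, x i ≠ x j) ∧
        IsEigenpair (lovaszExt (weightedCut (k + 2))) (lovaszExt (properIndicator (k + 2))) lam
          x} := by
    rintro _ ⟨i, rfl⟩
    exact ⟨descent (k + 2) i, ⟨_, _, (hasUniqueAscent_descent k i).1.ne⟩,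
      isEigenpair_weightedCut k i⟩
  refine le_trans ?_ (Set.encard_le_encard hsub)
  have hinj : Function.Injective fun i : Fin (k + 2) => ((i : ℕ) : ℝ) := fun i j h => by
    simpa [Fin.ext_iff] using h
  rw [← Set.image_univ, hinj.encard_image, Set.encard_univ, ENat.card_eq_coe_fintype_card,
    Fintype.card_fin]
  exact_mod_cast (by omega : k ≤ k + 2)

end OriginalExtension

/-! ### The disjoint-pair Lovász extension -/

section PairExtension

open Filter MeasureTheory

variable {V : Type*} [Fintype V] [DecidableEq V]

omit [Fintype V] [DecidableEq V] in
theorem disjointPair_ext {p q : DisjointPair V}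
    (h : ∀ i, (i ∈ p.1.1 ↔ i ∈ q.1.1) ∧ (i ∈ p.1.2 ↔ i ∈ q.1.2)) : p = q :=
  Subtype.ext (Prod.ext (Finset.ext fun i => (h i).1) (Finset.ext fun i => (h i).2))

omit [DecidableEq V] in
theorem mem_levelPair_left {x : V → ℝ} {t : ℝ} (ht : 0 ≤ t) {i : V} :
    i ∈ (levelPair x t).1.1 ↔ t < x i := by
  simp [levelPair, max_eq_left ht]

omit [DecidableEq V] in
theorem mem_levelPair_right {x : V → ℝ} {t : ℝ} (ht : 0 ≤ t) {i : V} :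
    i ∈ (levelPair x t).1.2 ↔ t < -x i := by
  simp [levelPair, max_eq_left ht]

omit [DecidableEq V] in
theorem levelPair_eq_iff {x : V → ℝ} {t : ℝ} (ht : 0 ≤ t) {p : DisjointPair V} :
    levelPair x t = p ↔ ∀ i, (t < x i ↔ i ∈ p.1.1) ∧ (t < -x i ↔ i ∈ p.1.2) := by
  constructor
  · rintro rfl i
    exact ⟨(mem_levelPair_left ht).symm, (mem_levelPair_right ht).symm⟩
  · intro h
    refine disjointPair_ext fun i => ?_
    rw [mem_levelPair_left ht, mem_levelPair_right ht]
    exact h i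

omit [DecidableEq V] in
theorem levelPair_ne_emptyPair {x : V → ℝ} {t : ℝ} (ht : 0 ≤ t) (htx : t < ‖x‖) :
    levelPair x t ≠ emptyPair := by
  intro h
  rw [levelPair_eq_iff ht] at h
  refine htx.not_ge ((pi_norm_le_iff_of_nonneg ht).2 fun i => ?_)
  have h1 : ¬ t < x i := by simpa [emptyPair] using (h i).1
  have h2 : ¬ t < -x i := by simpa [emptyPair] using (h i).2
  exact abs_le.2 ⟨by linarith, by linarith⟩

omit [Fintype V] in
theorem pairVec_of_mem_left {p : DisjointPair V} {i : V} (h : i ∈ p.1.1) : pairVec p i = 1 := by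
  have := Finset.disjoint_left.1 p.2 h
  simp [pairVec, indVec, h, this]

omit [Fintype V] in
theorem pairVec_of_mem_right {p : DisjointPair V} {i : V} (h : i ∈ p.1.2) :
    pairVec p i = -1 := by
  have := Finset.disjoint_right.1 p.2 h
  simp [pairVec, indVec, h, this]

omit [Fintype V] in
theorem pairVec_of_notMem {p : DisjointPair V} {i : V} (h1 : i ∉ p.1.1) (h2 : i ∉ p.1.2) :
    pairVec p i = 0 := by
  simp [pairVec, indVec, h1, h2]

theorem exists_mem_of_ne_emptyPair {p : DisjointPair V} (hp : p ≠ emptyPair) :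
    ∃ i, i ∈ p.1.1 ∨ i ∈ p.1.2 := by
  by_contra! h
  exact hp (disjointPair_ext fun i => by simp [emptyPair, h i])

theorem pairVec_ne_zero {p : DisjointPair V} (hp : p ≠ emptyPair) : pairVec p ≠ 0 := by
  obtain ⟨i, hi⟩ := exists_mem_of_ne_emptyPair hp
  intro h
  have h0 : pairVec p i = 0 := by rw [h]; rfl
  rcases hi with hi | hi
  · rw [pairVec_of_mem_left hi] at h0; norm_num at h0
  · rw [pairVec_of_mem_right hi] at h0; norm_num at h0

omit [Fintype V] in
theorem abs_pairVec_le (p : DisjointPair V) (i : V) : |pairVec p i| ≤ 1 := by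
  by_cases h1 : i ∈ p.1.1
  · simp [pairVec_of_mem_left h1]
  by_cases h2 : i ∈ p.1.2
  · simp [pairVec_of_mem_right h2]
  simp [pairVec_of_notMem h1 h2]

omit [DecidableEq V] in
theorem posHom_pairLovaszExt (f : DisjointPair V → ℝ) : PosHom (pairLovaszExt f) := by
  intro c x hc
  have h1 : ‖c • x‖ = c * ‖x‖ := by rw [norm_smul, Real.norm_of_nonneg hc.le]
  have h4 := intervalIntegral.mul_integral_comp_mul_left (a := 0) (b := ‖x‖)
    (f := fun t => f (levelPair (c • x) t)) c
  rw [mul_zero] at h4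
  rw [pairLovaszExt, h1, ← h4, pairLovaszExt]
  congr 1
  refine integral_congr_Ioo (norm_nonneg x) fun t ht _ => ?_
  congr 1
  rw [levelPair_eq_iff (by positivity)]
  intro i
  rw [mem_levelPair_left ht.le, mem_levelPair_right ht.le, Pi.smul_apply, smul_eq_mul,
    ← mul_neg, mul_lt_mul_iff_right₀ hc, mul_lt_mul_iff_right₀ hc]
  exact ⟨Iff.rfl, Iff.rfl⟩

/-- `p` is compatible with the vector `y` at height `η`: adding a positive multiple of `pairVec p`
to `y` keeps all level pairs of `y` and inserts `p` between those below and those above `η`. -/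
def FitsAt (p : DisjointPair V) (y : V → ℝ) (η : ℝ) : Prop :=
  ∀ i, (i ∈ p.1.1 → η ≤ y i) ∧ (i ∈ p.1.2 → y i ≤ -η) ∧
    (i ∉ p.1.1 → i ∉ p.1.2 → |y i| ≤ η)

theorem FitsAt.norm_add {p : DisjointPair V} {y : V → ℝ} {η c : ℝ} (h : FitsAt p y η)
    (hp : p ≠ emptyPair) (hη : 0 ≤ η) (hc : 0 ≤ c) : ‖y + c • pairVec p‖ = ‖y‖ + c := by
  obtain ⟨j, hj⟩ := exists_mem_of_ne_emptyPair hp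
  have : Nonempty V := ⟨j⟩
  apply le_antisymm
  · refine (pi_norm_le_iff_of_nonneg (by positivity)).2 fun i => ?_
    calc ‖(y + c • pairVec p) i‖ ≤ ‖y i‖ + ‖c * pairVec p i‖ := norm_add_le _ _
      _ ≤ ‖y‖ + c := by
        gcongr
        · exact norm_le_pi_norm y i
        · rw [norm_mul, Real.norm_of_nonneg hc]
          exact mul_le_of_le_one_right hc (abs_pairVec_le p i)
  · have key : ∀ i, (i ∈ p.1.1 ∨ i ∈ p.1.2) → |y i| + c ≤ ‖y + c • pairVec p‖ := by
      intro i hi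
      refine le_trans (le_of_eq ?_) (abs_apply_le_norm _ i)
      rw [Pi.add_apply, Pi.smul_apply, smul_eq_mul]
      rcases hi with hi | hi
      · have := (h i).1 hi
        rw [pairVec_of_mem_left hi, abs_of_nonneg (by linarith), abs_of_nonneg (by linarith)]
        ring
      · have := (h i).2.1 hi
        rw [pairVec_of_mem_right hi, abs_of_nonpos (by linarith), abs_of_nonpos (by linarith)]
        ring
    obtain ⟨i, hi⟩ := exists_abs_eq_norm y
    by_cases h1 : i ∈ p.1.1 ∨ i ∈ p.1.2
    · rw [← hi]; exact key i h1
    · push Not at h1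
      have h2 := (h i).2.2 h1.1 h1.2
      have h3 : η ≤ |y j| := by
        rcases hj with hj | hj
        · exact ((h j).1 hj).trans (le_abs_self _)
        · have := (h j).2.1 hj
          exact le_trans (by linarith) (neg_le_abs _)
      have := key j hj
      linarith

theorem FitsAt.le_norm {p : DisjointPair V} {y : V → ℝ} {η : ℝ} (h : FitsAt p y η)
    (hp : p ≠ emptyPair) : η ≤ ‖y‖ := by
  obtain ⟨j, hj⟩ := exists_mem_of_ne_emptyPair hp
  refine le_trans ?_ (abs_apply_le_norm y j)
  rcases hj with hj | hj
  · exact ((h j).1 hj).trans (le_abs_self _)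
  · have := (h j).2.1 hj
    exact le_trans (by linarith) (neg_le_abs _)

theorem FitsAt.pairLovaszExt_add {p : DisjointPair V} {y : V → ℝ} {η c : ℝ} (h : FitsAt p y η)
    (hp : p ≠ emptyPair) (hη : 0 ≤ η) (hc : 0 ≤ c) (f : DisjointPair V → ℝ) :
    pairLovaszExt f (y + c • pairVec p) = pairLovaszExt f y + c * f p := by
  have hyη := h.le_norm hp
  have hval : ∀ i, (y + c • pairVec p) i = y i + c * pairVec p i := fun i => rfl
  have hcases : ∀ i, (i ∈ p.1.1 ∧ i ∉ p.1.2 ∧ pairVec p i = 1 ∧ η ≤ y i) ∨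
      (i ∉ p.1.1 ∧ i ∈ p.1.2 ∧ pairVec p i = -1 ∧ y i ≤ -η) ∨
      (i ∉ p.1.1 ∧ i ∉ p.1.2 ∧ pairVec p i = 0 ∧ -η ≤ y i ∧ y i ≤ η) := by
    intro i
    by_cases h1 : i ∈ p.1.1
    · exact Or.inl ⟨h1, Finset.disjoint_left.1 p.2 h1, pairVec_of_mem_left h1, (h i).1 h1⟩
    by_cases h2 : i ∈ p.1.2
    · exact Or.inr (Or.inl ⟨h1, h2, pairVec_of_mem_right h2, (h i).2.1 h2⟩)
    · exact Or.inr (Or.inr ⟨h1, h2, pairVec_of_notMem h1 h2, abs_le.1 ((h i).2.2 h1 h2)⟩)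
  have hint := fun (x : V → ℝ) a b => intervalIntegrable_levelPair f x a b
  rw [pairLovaszExt, h.norm_add hp hη hc,
    ← intervalIntegral.integral_add_adjacent_intervals (hint _ 0 η) (hint _ η (‖y‖ + c)),
    ← intervalIntegral.integral_add_adjacent_intervals (hint _ η (η + c)) (hint _ (η + c) _)]
  -- levels below `η` are those of `y`, the next stretch of length `c` has the level pair `p`,
  -- and the remaining levels are those of `y` shifted by `c`
  have e1 : ∫ t in (0 : ℝ)..η, f (levelPair (y + c • pairVec p) t) =
      ∫ t in (0 : ℝ)..η, f (levelPair y t) := by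
    refine integral_congr_Ioo hη fun t ht1 ht2 => ?_
    congr 1
    rw [levelPair_eq_iff ht1.le]
    intro i
    rw [mem_levelPair_left ht1.le, mem_levelPair_right ht1.le, hval]
    rcases hcases i with ⟨-, -, h3, h4⟩ | ⟨-, -, h3, h4⟩ | ⟨-, -, h3, h4⟩ <;> rw [h3] <;>
      constructor <;> constructor <;> intro _ <;> linarith
  have e2 : ∫ t in η..(η + c), f (levelPair (y + c • pairVec p) t) = (η + c - η) * f p := by
    refine integral_const_Ioo (by linarith) fun t ht1 ht2 => ?_
    congr 1
    rw [levelPair_eq_iff (hη.trans ht1.le)]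
    intro i
    rw [hval]
    rcases hcases i with ⟨h1, h2, h3, h4⟩ | ⟨h1, h2, h3, h4⟩ | ⟨h1, h2, h3, h4⟩ <;>
      simp only [h1, h2, h3, iff_true, iff_false, not_lt] <;> constructor <;> linarith
  have e3 : ∫ t in (η + c)..(‖y‖ + c), f (levelPair (y + c • pairVec p) t) =
      ∫ t in η..‖y‖, f (levelPair y t) := by
    rw [← intervalIntegral.integral_comp_add_right
      (fun t => f (levelPair (y + c • pairVec p) t)) c]
    refine integral_congr_Ioo hyη fun t ht1 ht2 => ?_
    have ht0 := hη.trans ht1.le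
    congr 1
    rw [levelPair_eq_iff (by linarith)]
    intro i
    rw [mem_levelPair_left ht0, mem_levelPair_right ht0, hval]
    rcases hcases i with ⟨-, -, h3, h4⟩ | ⟨-, -, h3, h4⟩ | ⟨-, -, h3, h4⟩ <;> rw [h3] <;>
      constructor <;> constructor <;> intro _ <;> linarith
  rw [e1, e2, e3, pairLovaszExt,
    ← intervalIntegral.integral_add_adjacent_intervals (hint _ 0 η) (hint _ η ‖y‖)]
  ring

omit [DecidableEq V] in
/-- The height is taken just above `t`, below all larger absolute values of entries of `x`; then
compatibility persists near `x`. -/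
theorem exists_eventually_fitsAt (x : V → ℝ) {t : ℝ} (ht : 0 ≤ t) :
    ∃ η, 0 ≤ η ∧ ∀ᶠ y in 𝓝 x, FitsAt (levelPair x t) y η := by
  have h1 : ∀ᶠ η in 𝓝[>] t, ∀ i, (t < x i → η < x i) ∧ (t < -x i → η < -x i) := by
    refine eventually_all.2 fun i => ?_
    have h : ∀ a : ℝ, ∀ᶠ η in 𝓝[>] t, t < a → η < a := by
      intro a
      by_cases ha : t < a
      · filter_upwards [nhdsWithin_le_nhds (Iio_mem_nhds ha)] with η hη _ using hη
      · exact Eventually.of_forall fun _ h => absurd h ha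
    exact (h _).and (h _)
  obtain ⟨η, h2, h3⟩ := (h1.and self_mem_nhdsWithin).exists
  have h3 : t < η := h3
  refine ⟨η, by linarith, eventually_all.2 fun i => ?_⟩
  have hi : Continuous fun y : V → ℝ => y i := continuous_apply i
  rw [mem_levelPair_left ht, mem_levelPair_right ht]
  rcases lt_or_ge t (x i) with h4 | h4
  · filter_upwards [hi.tendsto x (Ioi_mem_nhds ((h2 i).1 h4))] with y hy
    have hy : η < y i := hy
    exact ⟨fun _ => hy.le, fun h => by linarith, fun h => absurd h4 h⟩
  rcases lt_or_ge t (-x i) with h5 | h5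
  · filter_upwards [hi.tendsto x (Iio_mem_nhds (lt_neg.1 ((h2 i).2 h5)))] with y hy
    have hy : y i < -η := hy
    exact ⟨fun h => by linarith, fun _ => hy.le, fun _ h => absurd h5 h⟩
  · filter_upwards [hi.tendsto x (Ioo_mem_nhds (show -η < x i by linarith)
      (show x i < η by linarith))] with y hy
    exact ⟨fun h => by linarith, fun h => by linarith,
      fun _ _ => abs_le.2 ⟨hy.1.le, hy.2.le⟩⟩

theorem isLinearAlong_pairLovaszExt (f : DisjointPair V → ℝ) {x : V → ℝ} {t : ℝ} (ht : 0 ≤ t)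
    (htx : t < ‖x‖) :
    IsLinearAlong (pairLovaszExt f) x (pairVec (levelPair x t)) (f (levelPair x t)) := by
  obtain ⟨η, hη, h⟩ := exists_eventually_fitsAt x ht
  filter_upwards [h] with y hy c hc
  exact hy.pairLovaszExt_add (levelPair_ne_emptyPair ht htx) hη hc f

/-- Every level pair of an eigenvector is itself an eigenset. -/
theorem IsEigenpair.at_levelPair {f g : DisjointPair V → ℝ} {lam : ℝ} {x : V → ℝ}
    (h : IsEigenpair (pairLovaszExt f) (pairLovaszExt g) lam x) {t : ℝ} (ht : 0 ≤ t)
    (htx : t < ‖x‖) :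
    f (levelPair x t) = lam * g (levelPair x t) ∧
      IsEigenpair (pairLovaszExt f) (pairLovaszExt g) lam (pairVec (levelPair x t)) :=
  ⟨h.dotProduct_eq (isLinearAlong_pairLovaszExt f ht htx) (isLinearAlong_pairLovaszExt g ht htx),
    h.of_isLinearAlong (pairVec_ne_zero (levelPair_ne_emptyPair ht htx))
      (posHom_pairLovaszExt f) (posHom_pairLovaszExt g)
      (isLinearAlong_pairLovaszExt f ht htx) (isLinearAlong_pairLovaszExt g ht htx)⟩

/-! ### Functions that split evenly -/

/-- For an evenly splitting `f` the two families of level sets, of `x` and of `-x`, combine to one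
family of levels between `-‖x‖` and `‖x‖`. -/
theorem SplitsEvenly.two_mul_pairLovaszExt {f : DisjointPair V → ℝ} (hf : SplitsEvenly f)
    (x : V → ℝ) :
    2 * pairLovaszExt f x = ∫ t in (-‖x‖)..‖x‖, f (pairLeft (upperLevel x t)) := by
  have hint := fun a b => intervalIntegrable_upperLevel (fun S => f (pairLeft S)) x a b
  have hint2 := fun a b =>
    intervalIntegrable_upperLevel (fun S => f (pairRight S)) (-x) a b
  rw [← intervalIntegral.integral_add_adjacent_intervals (hint (-‖x‖) 0) (hint 0 ‖x‖)]
  have e1 : ∫ t in (-‖x‖)..0, f (pairLeft (upperLevel x t)) =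
      ∫ t in (0 : ℝ)..‖x‖, f (pairRight (upperLevel (-x) t)) := by
    have h := intervalIntegral.integral_comp_neg (a := 0) (b := ‖x‖)
      (fun t => f (pairLeft (upperLevel x t)))
    rw [neg_zero] at h
    rw [← h]
    -- `{x > -t}` and `{x ≥ -t}` agree for all but finitely many `t`
    refine intervalIntegral.integral_congr_ae ?_
    have hfin : (Set.range fun i => -x i).Countable := (Set.finite_range _).countable
    filter_upwards [hfin.ae_notMem volume] with t ht _
    congr 1
    refine disjointPair_ext fun i => ?_
    have hi : t ≠ -x i := fun h => ht ⟨i, h.symm⟩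
    have : -t < x i ↔ -x i ≤ t := by
      constructor
      · intro h; linarith
      · intro h
        have := lt_of_le_of_ne h hi.symm
        linarith
    simp [pairLeft, pairRight, this, not_lt]
  rw [e1, ← intervalIntegral.integral_add (hint2 _ _) (hint _ _), pairLovaszExt,
    ← intervalIntegral.integral_const_mul]
  refine integral_congr_Ioo (norm_nonneg x) fun t ht1 ht2 => ?_
  rw [hf _ (levelPair_ne_emptyPair ht1.le ht2), add_comm]
  simp [levelPair, max_eq_left ht1.le]

/-- Conditions that persist near a vector and make an evenly splitting function linear in the
direction `1_A - 1_{V \ A}`: `A` is an upper set of `y`, and it is trivial only if `y` has the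
constant sign of that direction. -/
def IsSignedUpperSet (A : Finset V) (y : V → ℝ) : Prop :=
  (∀ a ∈ A, ∀ b ∉ A, y b < y a) ∧ (A = ∅ → ∀ i, y i < 0) ∧ (A = Finset.univ → ∀ i, 0 < y i)

theorem eventually_isSignedUpperSet {A : Finset V} {x : V → ℝ} (h : IsSignedUpperSet A x) :
    ∀ᶠ y in 𝓝 x, IsSignedUpperSet A y := by
  have hi : ∀ i, Continuous fun y : V → ℝ => y i := continuous_apply
  refine Eventually.and ?_ (Eventually.and ?_ ?_)
  · refine eventually_all.2 fun a => ?_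
    by_cases ha : a ∈ A
    · refine (eventually_all.2 fun b => ?_).mono fun y hy _ => hy
      by_cases hb : b ∈ A
      · exact Eventually.of_forall fun _ h => absurd hb h
      · filter_upwards [(isOpen_lt (hi b) (hi a)).mem_nhds (h.1 a ha b hb)] with y hy _ using hy
    · exact Eventually.of_forall fun _ h => absurd h ha
  · by_cases hA : A = ∅
    · refine (eventually_all.2 fun i => ?_).mono fun y hy _ => hy
      exact (isOpen_lt (hi i) continuous_const).mem_nhds (h.2.1 hA i)
    · exact Eventually.of_forall fun _ h => absurd h hA
  · by_cases hA : A = Finset.univ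
    · refine (eventually_all.2 fun i => ?_).mono fun y hy _ => hy
      exact (isOpen_lt continuous_const (hi i)).mem_nhds (h.2.2 hA i)
    · exact Eventually.of_forall fun _ h => absurd h hA

omit [DecidableEq V] in
theorem exists_isSignedUpperSet {x : V → ℝ} (hx : x ≠ 0) : ∃ A, IsSignedUpperSet A x := by
  by_cases hc : ∃ i j, x i < x j
  · obtain ⟨i, j, hij⟩ := hc
    refine ⟨upperLevel x (x i), fun a ha b hb => ?_, fun h => ?_, fun h => ?_⟩
    · rw [mem_upperLevel] at ha hb
      linarith
    · exact absurd (h ▸ mem_upperLevel.2 hij) (Finset.notMem_empty j)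
    · have : i ∈ upperLevel x (x i) := h ▸ Finset.mem_univ i
      exact absurd (mem_upperLevel.1 this) (lt_irrefl _)
  · push Not at hc
    obtain ⟨j, hj⟩ := Function.ne_iff.1 hx
    have hall : ∀ i, x i = x j := fun i => le_antisymm (hc _ _) (hc _ _)
    rcases lt_or_gt_of_ne hj with hj | hj
    · refine ⟨∅, by simp, fun _ i => by rw [hall i]; exact hj, fun h => ?_⟩
      exact absurd (h ▸ Finset.mem_univ j) (Finset.notMem_empty j)
    · refine ⟨Finset.univ, by simp, fun h => ?_, fun _ i => by rw [hall i]; exact hj⟩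
      exact absurd (h ▸ Finset.mem_univ j) (Finset.notMem_empty j)

theorem pairVec_pairLeft_of_mem {A : Finset V} {i : V} (h : i ∈ A) :
    pairVec (pairLeft A) i = 1 := pairVec_of_mem_left h

theorem pairVec_pairLeft_of_notMem {A : Finset V} {i : V} (h : i ∉ A) :
    pairVec (pairLeft A) i = -1 := pairVec_of_mem_right (Finset.mem_compl.2 h)

theorem pairLeft_ne_emptyPair [Nonempty V] (A : Finset V) : pairLeft A ≠ emptyPair := by
  intro h
  have h1 : A = ∅ := congrArg (fun p => p.1.1) h
  have h2 : Aᶜ = ∅ := congrArg (fun p => p.1.2) h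
  rw [h1, Finset.compl_empty] at h2
  exact Finset.univ_nonempty.ne_empty h2

theorem IsSignedUpperSet.norm_add [Nonempty V] {A : Finset V} {y : V → ℝ} {c : ℝ}
    (h : IsSignedUpperSet A y) (hc : 0 ≤ c) : ‖y + c • pairVec (pairLeft A)‖ = ‖y‖ + c := by
  have hval : ∀ i, (y + c • pairVec (pairLeft A)) i = y i + c * pairVec (pairLeft A) i :=
    fun i => rfl
  apply le_antisymm
  · refine (pi_norm_le_iff_of_nonneg (by positivity)).2 fun i => ?_
    calc ‖(y + c • pairVec (pairLeft A)) i‖ ≤ ‖y i‖ + ‖c * pairVec (pairLeft A) i‖ :=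
          norm_add_le _ _
      _ ≤ ‖y‖ + c := by
        gcongr
        · exact norm_le_pi_norm y i
        · rw [norm_mul, Real.norm_of_nonneg hc]
          exact mul_le_of_le_one_right hc (abs_pairVec_le _ i)
  · obtain ⟨i, hi⟩ := exists_abs_eq_norm y
    -- an entry of largest absolute value has the sign of the direction
    have hsign : (i ∈ A ∧ y i = ‖y‖) ∨ (i ∉ A ∧ y i = -‖y‖) := by
      have hb := fun j => abs_le.1 (abs_apply_le_norm y j)
      by_cases hiA : i ∈ A
      · refine Or.inl ⟨hiA, ?_⟩
        rcases abs_choice (y i) with e | e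
        · rw [← hi, e]
        by_cases hA : A = Finset.univ
        · rw [← hi, abs_of_pos (h.2.2 hA i)]
        · obtain ⟨j, hj⟩ : ∃ j, j ∉ A := by
            by_contra! hall
            exact hA (Finset.eq_univ_iff_forall.2 hall)
          have := h.1 i hiA j hj
          have := (hb j).1
          linarith
      · refine Or.inr ⟨hiA, ?_⟩
        rcases abs_choice (y i) with e | e
        · by_cases hA : A = ∅
          · have := h.2.1 hA i
            rw [← hi, abs_of_neg this, neg_neg]
          · obtain ⟨j, hj⟩ := Finset.nonempty_iff_ne_empty.2 hA
            have := h.1 j hj i hiA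
            have := (hb j).2
            linarith
        · linarith
    refine le_trans (le_of_eq ?_) (abs_apply_le_norm _ i)
    have hn := norm_nonneg y
    rcases hsign with ⟨h1, h2⟩ | ⟨h1, h2⟩
    · rw [hval, pairVec_pairLeft_of_mem h1, h2, abs_of_nonneg (by linarith)]
      ring
    · rw [hval, pairVec_pairLeft_of_notMem h1, h2, abs_of_nonpos (by linarith)]
      ring

theorem IsSignedUpperSet.pairLovaszExt_add [Nonempty V] {A : Finset V} {y : V → ℝ} {c : ℝ}
    (h : IsSignedUpperSet A y) (hc : 0 ≤ c) {f : DisjointPair V → ℝ} (hf : SplitsEvenly f) :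
    pairLovaszExt f (y + c • pairVec (pairLeft A)) =
      pairLovaszExt f y + c * f (pairLeft A) := by
  have hval : ∀ i, (y + c • pairVec (pairLeft A)) i = y i + c * pairVec (pairLeft A) i :=
    fun i => rfl
  have hb := fun j => abs_le.1 (abs_apply_le_norm y j)
  obtain ⟨η, hη1, hη2, hA, hB⟩ : ∃ η, -‖y‖ ≤ η ∧ η ≤ ‖y‖ ∧ (∀ i ∈ A, η ≤ y i) ∧
      (∀ i ∉ A, y i ≤ η) := by
    by_cases hA : A.Nonempty
    · obtain ⟨a, ha, hmin⟩ := A.exists_min_image y hA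
      exact ⟨y a, (hb a).1, (hb a).2, hmin, fun i hi => (h.1 a ha i hi).le⟩
    · rw [Finset.not_nonempty_iff_eq_empty] at hA
      refine ⟨‖y‖, by linarith [norm_nonneg y], le_rfl, by simp [hA], fun i _ => (hb i).2⟩
  have hcases : ∀ i, (i ∈ A ∧ pairVec (pairLeft A) i = 1 ∧ η ≤ y i) ∨
      (i ∉ A ∧ pairVec (pairLeft A) i = -1 ∧ y i ≤ η) := by
    intro i
    by_cases hi : i ∈ A
    · exact Or.inl ⟨hi, pairVec_pairLeft_of_mem hi, hA i hi⟩
    · exact Or.inr ⟨hi, pairVec_pairLeft_of_notMem hi, hB i hi⟩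
  set z := y + c • pairVec (pairLeft A) with hz
  have hint := fun (x : V → ℝ) a b =>
    intervalIntegrable_upperLevel (fun S => f (pairLeft S)) x a b
  have e1 : ∫ t in (-(‖y‖ + c))..(η - c), f (pairLeft (upperLevel z t)) =
      ∫ t in (-‖y‖)..η, f (pairLeft (upperLevel y t)) := by
    rw [show -(‖y‖ + c) = -‖y‖ - c by ring, ← intervalIntegral.integral_comp_sub_right
      (fun t => f (pairLeft (upperLevel z t))) c]
    refine integral_congr_Ioo hη1 fun t ht1 ht2 => ?_
    congr 2
    ext i
    rw [mem_upperLevel, mem_upperLevel, hval]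
    rcases hcases i with ⟨-, h3, h4⟩ | ⟨-, h3, h4⟩ <;> rw [h3] <;>
      constructor <;> intro _ <;> linarith
  have e2 : ∫ t in (η - c)..(η + c), f (pairLeft (upperLevel z t)) =
      (η + c - (η - c)) * f (pairLeft A) := by
    refine integral_const_Ioo (by linarith) fun t ht1 ht2 => ?_
    congr 2
    ext i
    rw [mem_upperLevel, hval]
    rcases hcases i with ⟨h1, h3, h4⟩ | ⟨h1, h3, h4⟩ <;>
      simp only [h1, h3, iff_true, iff_false, not_lt] <;> linarith
  have e3 : ∫ t in (η + c)..(‖y‖ + c), f (pairLeft (upperLevel z t)) =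
      ∫ t in η..‖y‖, f (pairLeft (upperLevel y t)) := by
    rw [← intervalIntegral.integral_comp_add_right
      (fun t => f (pairLeft (upperLevel z t))) c]
    refine integral_congr_Ioo hη2 fun t ht1 ht2 => ?_
    congr 2
    ext i
    rw [mem_upperLevel, mem_upperLevel, hval]
    rcases hcases i with ⟨-, h3, h4⟩ | ⟨-, h3, h4⟩ <;> rw [h3] <;>
      constructor <;> intro _ <;> linarith
  have k1 := hf.two_mul_pairLovaszExt z
  rw [h.norm_add hc,
    ← intervalIntegral.integral_add_adjacent_intervals (hint z (-(‖y‖ + c)) (η - c))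
      (hint z (η - c) (‖y‖ + c)),
    ← intervalIntegral.integral_add_adjacent_intervals (hint z (η - c) (η + c))
      (hint z (η + c) (‖y‖ + c)), e1, e2, e3] at k1
  have k2 := hf.two_mul_pairLovaszExt y
  rw [← intervalIntegral.integral_add_adjacent_intervals (hint y (-‖y‖) η)
      (hint y η ‖y‖)] at k2
  linarith

theorem IsEigenpair.exists_pairLeft [Nonempty V] {f g : DisjointPair V → ℝ} {lam : ℝ}
    {x : V → ℝ} (h : IsEigenpair (pairLovaszExt f) (pairLovaszExt g) lam x)
    (hf : SplitsEvenly f) (hg : SplitsEvenly g) :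
    ∃ A : Finset V, f (pairLeft A) = lam * g (pairLeft A) ∧
      IsEigenpair (pairLovaszExt f) (pairLovaszExt g) lam (pairVec (pairLeft A)) := by
  obtain ⟨A, hA⟩ := exists_isSignedUpperSet h.1
  have key : ∀ f : DisjointPair V → ℝ, SplitsEvenly f →
      IsLinearAlong (pairLovaszExt f) x (pairVec (pairLeft A)) (f (pairLeft A)) := by
    intro f hf
    filter_upwards [eventually_isSignedUpperSet hA] with y hy c hc
    exact hy.pairLovaszExt_add hc hf
  exact ⟨A, h.dotProduct_eq (key f hf) (key g hg),
    h.of_isLinearAlong (pairVec_ne_zero (pairLeft_ne_emptyPair A))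
      (posHom_pairLovaszExt f) (posHom_pairLovaszExt g) (key f hf) (key g hg)⟩

end PairExtension

/-! ### Gradients along maximal chains of level pairs -/

section ChainGradients

open Filter MeasureTheory

variable {V : Type*} [Fintype V] [DecidableEq V]

theorem integral_ite_lt {a w M : ℝ} (haM : a ≤ M) (hM : 0 ≤ M) :
    ∫ t in (0 : ℝ)..M, (if t < a then w else 0) = w * max a 0 := by
  rcases le_or_gt a 0 with ha | ha
  · rw [integral_const_Ioo (k := 0) hM fun t h1 _ => if_neg (by linarith), max_eq_right ha]
    ring
  · have h1 : ∫ t in (0 : ℝ)..a, (if t < a then w else 0) = (a - 0) * w :=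
      integral_const_Ioo ha.le fun t _ h => if_pos h
    have h2 : ∫ t in a..M, (if t < a then w else 0) = (M - a) * 0 :=
      integral_const_Ioo haM fun t h _ => if_neg h.not_gt
    have hm : ∀ b c : ℝ, IntervalIntegrable (fun t => if t < a then w else 0) volume b c := by
      have h := fun b c => intervalIntegrable_upperLevel
        (fun S : Finset (Fin 1) => if (0 : Fin 1) ∈ S then w else 0) (fun _ => a) b c
      simpa using h
    rw [← intervalIntegral.integral_add_adjacent_intervals (hm 0 a) (hm a M), h1, h2,
      max_eq_left ha.le]
    ring

/-- The integral of a modular function over the upper level sets. -/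
theorem integral_sum_upperLevel (w z : V → ℝ) {M : ℝ} (hz : ∀ i, z i ≤ M) (hM : 0 ≤ M) :
    ∫ t in (0 : ℝ)..M, ∑ i ∈ upperLevel z t, w i = ∑ i, w i * max (z i) 0 := by
  have h1 : ∀ t, ∑ i ∈ upperLevel z t, w i = ∑ i, if t < z i then w i else 0 := by
    intro t
    rw [upperLevel, Finset.sum_filter]
  simp only [h1]
  rw [intervalIntegral.integral_finsetSum]
  · exact Finset.sum_congr rfl fun i _ => integral_ite_lt (hz i) hM
  · intro i _
    have h := intervalIntegrable_upperLevel (fun S : Finset V => if i ∈ S then w i else 0) z 0 M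
    simpa using h

/-- The contribution of `i` to `φ` when the elements of `V` are added in decreasing order of
rank. -/
def marginal (φ : Finset V → ℝ) (r : V ≃ Fin (Fintype.card V)) (i : V) : ℝ :=
  φ {j | r i ≤ r j} - φ {j | r i < r j}

theorem sum_marginal {φ : Finset V → ℝ} (h0 : φ ∅ = 0) (r : V ≃ Fin (Fintype.card V))
    {U : Finset V} (hU : ∀ i ∈ U, ∀ j, r i ≤ r j → j ∈ U) : ∑ i ∈ U, marginal φ r i = φ U := by
  induction U using Finset.strongInduction with
  | H U ih =>
    rcases U.eq_empty_or_nonempty with rfl | hne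
    · simp [h0]
    obtain ⟨i, hi, hmin⟩ := U.exists_min_image r hne
    have e1 : ({j | r i ≤ r j} : Finset V) = U := by
      ext j
      simp only [Finset.mem_filter, Finset.mem_univ, true_and]
      exact ⟨hU i hi j, hmin j⟩
    have e2 : ({j | r i < r j} : Finset V) = U.erase i := by
      ext j
      simp only [Finset.mem_filter, Finset.mem_univ, true_and, Finset.mem_erase]
      constructor
      · exact fun h => ⟨fun e => by simp [e] at h, hU i hi j h.le⟩
      · exact fun h => lt_of_le_of_ne (hmin j h.2) fun e => h.1 (r.injective e).symm
    rw [← Finset.add_sum_erase U _ hi, ih _ (Finset.erase_ssubset hi), marginal, e1, e2]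
    · ring
    · intro k hk j hj
      rw [← e2, Finset.mem_filter] at hk ⊢
      exact ⟨Finset.mem_univ j, hk.2.trans_le hj⟩

theorem integral_eq_sum_marginal {φ : Finset V → ℝ} (h0 : φ ∅ = 0)
    {r : V ≃ Fin (Fintype.card V)} {z : V → ℝ} (hz : ∀ i j, r i ≤ r j → z i ≤ z j)
    (hz0 : ∀ i, 0 ≤ z i) {M : ℝ} (hM0 : 0 ≤ M) (hM : ∀ i, z i ≤ M) :
    ∫ t in (0 : ℝ)..M, φ (upperLevel z t) = ∑ i, marginal φ r i * z i := by
  have h1 : ∀ t, φ (upperLevel z t) = ∑ i ∈ upperLevel z t, marginal φ r i := by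
    intro t
    refine (sum_marginal h0 r fun i hi j hij => ?_).symm
    rw [mem_upperLevel] at hi ⊢
    exact hi.trans_le (hz i j hij)
  simp only [h1]
  rw [integral_sum_upperLevel _ _ hM hM0]
  exact Finset.sum_congr rfl fun i _ => by rw [max_eq_left (hz0 i)]

/-- The pair `(A ∩ S, S \ A)`. -/
def restrictPair (A S : Finset V) : DisjointPair V :=
  ⟨(A ∩ S, Aᶜ ∩ S), Disjoint.mono Finset.inter_subset_left Finset.inter_subset_left
    disjoint_compl_right⟩

/-- The restriction of `f` to the pairs `(A ∩ S, S \ A)`, with value zero at `S = ∅`. -/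
def restrictTo (f : DisjointPair V → ℝ) (A S : Finset V) : ℝ :=
  if S = ∅ then 0 else f (restrictPair A S)

/-- The gradient of the Lovász extension of `f` on the cone of vectors that are positive on `A`,
negative off `A`, and whose absolute values are ordered like `r`. -/
def chainGradient (f : DisjointPair V → ℝ) (A : Finset V) (r : V ≃ Fin (Fintype.card V)) :
    V → ℝ := fun i => pairVec (pairLeft A) i * marginal (restrictTo f A) r i

theorem pairLovaszExt_eq_chainGradient (f : DisjointPair V → ℝ) {A : Finset V}
    {r : V ≃ Fin (Fintype.card V)} {z : V → ℝ} (hA : ∀ i ∈ A, 0 < z i) (hB : ∀ i ∉ A, z i < 0)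
    (hr : ∀ i j, r i ≤ r j → |z i| ≤ |z j|) :
    pairLovaszExt f z = chainGradient f A r ⬝ᵥ z := by
  have h1 : ∑ i, marginal (restrictTo f A) r i * |z i| = chainGradient f A r ⬝ᵥ z := by
    refine Finset.sum_congr rfl fun i _ => ?_
    rw [chainGradient]
    by_cases hi : i ∈ A
    · rw [pairVec_pairLeft_of_mem hi, abs_of_pos (hA i hi)]
      ring
    · rw [pairVec_pairLeft_of_notMem hi, abs_of_neg (hB i hi)]
      ring
  rw [← h1, ← integral_eq_sum_marginal (φ := restrictTo f A) (by simp [restrictTo]) hr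
    (fun i => abs_nonneg _) (norm_nonneg z) (abs_apply_le_norm z), pairLovaszExt]
  refine integral_congr_Ioo (norm_nonneg z) fun t ht1 ht2 => ?_
  have h2 : levelPair z t = restrictPair A (upperLevel (fun i => |z i|) t) := by
    rw [levelPair_eq_iff ht1.le]
    intro i
    simp only [restrictPair, Finset.mem_inter, mem_upperLevel, Finset.mem_compl]
    by_cases hi : i ∈ A
    · have := hA i hi
      simp only [hi, abs_of_pos this, true_and, not_true, false_and, iff_false, not_lt]
      linarith
    · have := hB i hi
      simp only [hi, abs_of_neg this, true_and, not_false_eq_true, false_and, iff_false, not_lt]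
      exact ⟨by linarith, trivial⟩
  rw [restrictTo, if_neg, h2]
  intro h3
  refine levelPair_ne_emptyPair ht1.le ht2 ?_
  rw [h2, h3]
  exact disjointPair_ext fun i => by simp [restrictPair, emptyPair]

theorem levelPair_zero_of_sign {A : Finset V} {z : V → ℝ} (hA : ∀ i ∈ A, 0 < z i)
    (hB : ∀ i ∉ A, z i < 0) : levelPair z 0 = pairLeft A := by
  rw [levelPair_eq_iff le_rfl]
  intro i
  by_cases hi : i ∈ A
  · have := hA i hi
    simp [pairLeft, hi, this, this.le]
  · have := hB i hi
    simp [pairLeft, hi, this, this.le]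

theorem chainGradient_mem_clarkeSubdiff [Nonempty V] (f : DisjointPair V → ℝ) (A : Finset V)
    (r : V ≃ Fin (Fintype.card V)) :
    chainGradient f A r ∈ clarkeSubdiff (pairLovaszExt f) (pairVec (pairLeft A)) := by
  set y : V → ℝ := fun i => pairVec (pairLeft A) i * (1 + (r i : ℕ)) with hy
  have hpos : ∀ i, (0 : ℝ) < 1 + (r i : ℕ) := fun i => by positivity
  have hyA : ∀ i ∈ A, y i = 1 + (r i : ℕ) := fun i hi => by
    simp [hy, pairVec_pairLeft_of_mem hi]
  have hyB : ∀ i ∉ A, y i = -(1 + (r i : ℕ)) := fun i hi => by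
    simp only [hy, pairVec_pairLeft_of_notMem hi]; ring
  have hyabs : ∀ i, |y i| = 1 + (r i : ℕ) := fun i => by
    by_cases hi : i ∈ A
    · rw [hyA i hi, abs_of_pos (hpos i)]
    · rw [hyB i hi, abs_neg, abs_of_pos (hpos i)]
  have hc : ∀ i, Continuous fun z : V → ℝ => z i := continuous_apply
  have hmem : chainGradient f A r ∈ clarkeSubdiff (pairLovaszExt f) y := by
    refine mem_clarkeSubdiff_of_eventuallyEq ?_
    have hsign : ∀ᶠ z in 𝓝 y, ∀ i, (i ∈ A → 0 < z i) ∧ (i ∉ A → z i < 0) := by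
      refine eventually_all.2 fun i => ?_
      by_cases hi : i ∈ A
      · filter_upwards [(isOpen_lt continuous_const (hc i)).mem_nhds
          (show 0 < y i by rw [hyA i hi]; exact hpos i)] with z hz
        exact ⟨fun _ => hz, fun h => absurd hi h⟩
      · filter_upwards [(isOpen_lt (hc i) continuous_const).mem_nhds
          (show y i < 0 by rw [hyB i hi]; linarith [hpos i])] with z hz
        exact ⟨fun h => absurd h hi, fun _ => hz⟩
    have hord : ∀ᶠ z in 𝓝 y, ∀ i j, r i < r j → |z i| < |z j| := by
      refine eventually_all.2 fun i => eventually_all.2 fun j => ?_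
      by_cases hij : r i < r j
      · filter_upwards [(isOpen_lt (hc i).abs (hc j).abs).mem_nhds
          (show |y i| < |y j| by
            rw [hyabs, hyabs]
            exact add_lt_add_right (by exact_mod_cast hij) 1)] with z hz _ using hz
      · exact Eventually.of_forall fun _ h => absurd h hij
    filter_upwards [hsign, hord] with z h1 h2
    refine pairLovaszExt_eq_chainGradient f (fun i => (h1 i).1) (fun i => (h1 i).2) ?_
    intro i j hij
    rcases hij.lt_or_eq with h | h
    · exact (h2 i j h).le
    · rw [r.injective h]
  have hlev : levelPair y 0 = pairLeft A :=
    levelPair_zero_of_sign (fun i hi => by rw [hyA i hi]; exact hpos i)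
      fun i hi => by rw [hyB i hi]; linarith [hpos i]
  have hny : 0 < ‖y‖ := by
    obtain ⟨i⟩ := ‹Nonempty V›
    exact lt_of_lt_of_le (by rw [hyabs]; exact hpos i) (abs_apply_le_norm y i)
  have hlin := isLinearAlong_pairLovaszExt f le_rfl hny
  rw [hlev] at hlin
  exact hlin.clarkeSubdiff_subset (posHom_pairLovaszExt f) hmem

omit [DecidableEq V] in
/-- Every vector is weakly increasing with respect to some ranking. -/
theorem exists_ranking (h : V → ℝ) :
    ∃ r : V ≃ Fin (Fintype.card V), ∀ i j, r i ≤ r j → h i ≤ h j := by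
  set e := Fintype.equivFin V
  refine ⟨e.trans (Tuple.sort (h ∘ e.symm)).symm, fun i j hij => ?_⟩
  have := Tuple.monotone_sort (h ∘ e.symm) hij
  simpa using this

/-- If `f ≥ 0`, no linear functional separates the chain gradients at `1_A - 1_{V \ A}` from the
orthant of that vector: a functional that is nonnegative on the orthant pairs with the chain
gradient of its own ranking to an integral of values of `f`. -/
theorem exists_mem_convexHull_chainGradient {f : DisjointPair V → ℝ}
    (hf : ∀ p, p ≠ emptyPair → 0 ≤ f p) (A : Finset V) :
    ∃ w ∈ convexHull ℝ (Set.range (chainGradient f A)),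
      ∀ i, 0 ≤ pairVec (pairLeft A) i * w i := by
  set s := pairVec (pairLeft A) with hs
  have hss : ∀ i, s i * s i = 1 := fun i => by
    by_cases hi : i ∈ A
    · rw [hs, pairVec_pairLeft_of_mem hi]; norm_num
    · rw [hs, pairVec_pairLeft_of_notMem hi]; norm_num
  set O : Set (V → ℝ) := {w | ∀ i, 0 ≤ s i * w i} with hO
  by_contra! hcon
  have hdisj : Disjoint (convexHull ℝ (Set.range (chainGradient f A))) O := by
    refine Set.disjoint_left.2 fun w hw hwO => ?_
    obtain ⟨i, hi⟩ := hcon w hw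
    exact hi.not_ge (hwO i)
  have hOc : Convex ℝ O := by
    intro u hu v hv a b ha hb _ i
    have h1 := mul_nonneg ha (hu i)
    have h2 := mul_nonneg hb (hv i)
    simp only [Pi.add_apply, Pi.smul_apply, smul_eq_mul]
    linarith
  have hOcl : IsClosed O := by
    simp only [hO, Set.ofPred_forall]
    exact isClosed_iInter fun i => isClosed_le continuous_const (by fun_prop)
  obtain ⟨ℓ, a, b, h1, h2, h3⟩ := geometric_hahn_banach_compact_closed
    (convex_convexHull ℝ _) ((Set.finite_range (chainGradient f A)).isCompact_convexHull (𝕜 := ℝ))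
    hOc hOcl hdisj
  have hb : b < 0 := by simpa using h3 0 (fun i => by simp)
  have hℓ : ∀ u : V → ℝ, ℓ u = ∑ i, u i * ℓ (Pi.single i 1) := by
    intro u
    conv_lhs => rw [pi_eq_sum_univ' u]
    simp
  set h : V → ℝ := fun i => s i * ℓ (Pi.single i 1) with hh
  have hh0 : ∀ i, 0 ≤ h i := by
    intro i
    by_contra! hneg
    -- a negative value on a ray of the orthant would make `ℓ` unbounded below there
    have hmem : (b / h i) • Pi.single i (s i) ∈ O := by
      intro j
      by_cases hj : j = i
      · subst hj
        simp only [Pi.smul_apply, Pi.single_eq_same, smul_eq_mul]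
        rw [mul_left_comm, hss, mul_one]
        exact div_nonneg_of_nonpos hb.le hneg.le
      · simp [hj]
    have h4 := h3 _ hmem
    have h5 : (Pi.single i (s i) : V → ℝ) = s i • Pi.single i 1 := by
      rw [← Pi.single_smul, smul_eq_mul, mul_one]
    rw [map_smul, h5, map_smul, smul_eq_mul, smul_eq_mul, div_mul_cancel₀ _ hneg.ne] at h4
    exact lt_irrefl _ h4
  obtain ⟨r, hr⟩ := exists_ranking h
  have h6 := h1 _ (subset_convexHull ℝ _ (Set.mem_range_self r))
  have h7 : ℓ (chainGradient f A r) = ∑ i, marginal (restrictTo f A) r i * h i := by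
    rw [hℓ]
    refine Finset.sum_congr rfl fun i _ => ?_
    rw [chainGradient, hh]
    ring
  have h8 : 0 ≤ ℓ (chainGradient f A r) := by
    rw [h7, ← integral_eq_sum_marginal (φ := restrictTo f A) (by simp [restrictTo]) hr hh0
      (norm_nonneg h) fun i => (le_abs_self _).trans (abs_apply_le_norm h i)]
    refine intervalIntegral.integral_nonneg (norm_nonneg h) fun t _ => ?_
    rw [restrictTo]
    split_ifs with hS
    · exact le_rfl
    · refine hf _ fun he => hS ?_
      obtain ⟨k1, k2⟩ := Prod.ext_iff.1 (congrArg Subtype.val he)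
      have k1 : A ∩ _ = ∅ := k1
      have k2 : Aᶜ ∩ _ = ∅ := k2
      ext i
      have m1 := Finset.ext_iff.1 k1 i
      have m2 := Finset.ext_iff.1 k2 i
      simp only [Finset.mem_inter, Finset.mem_compl, Finset.notMem_empty, iff_false] at m1 m2 ⊢
      tauto
  linarith

theorem single_mem_clarkeSubdiff [Nonempty V] {g : DisjointPair V → ℝ} {c : ℝ}
    (hg : ∀ p, p ≠ emptyPair → g p = c) (A : Finset V) (i : V) :
    Pi.single i (c * pairVec (pairLeft A) i) ∈
      clarkeSubdiff (pairLovaszExt g) (pairVec (pairLeft A)) := by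
  obtain ⟨r, hr⟩ := exists_ranking (Pi.single i 1 : V → ℝ)
  have htop : ∀ j, j ≠ i → r j < r i := by
    intro j hj
    by_contra! h
    have := hr i j h
    simp only [Pi.single_eq_same, Pi.single_eq_of_ne hj] at this
    linarith
  have hval : ∀ S : Finset V, S.Nonempty → restrictTo g A S = c := by
    intro S ⟨j, hj⟩
    rw [restrictTo, if_neg (Finset.ne_empty_of_mem hj)]
    refine hg _ fun he => ?_
    obtain ⟨k1, k2⟩ := Prod.ext_iff.1 (congrArg Subtype.val he)
    have m1 := Finset.ext_iff.1 k1 j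
    have m2 := Finset.ext_iff.1 k2 j
    simp [restrictPair, emptyPair, hj] at m1 m2
    exact m1 m2
  convert chainGradient_mem_clarkeSubdiff g A r using 1
  ext j
  rw [chainGradient, marginal, hval _ ⟨j, by simp⟩]
  by_cases hj : j = i
  · subst hj
    have : ({k | r j < r k} : Finset V) = ∅ := by
      refine Finset.filter_eq_empty_iff.2 fun k _ => ?_
      by_cases hk : k = j
      · simp [hk]
      · exact (htop k hk).not_gt
    rw [this, restrictTo, if_pos rfl, Pi.single_eq_same]
    ring
  · rw [hval _ ⟨i, by simpa using htop j hj⟩, Pi.single_eq_of_ne hj]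
    ring

theorem exists_isEigenpair_pairLeft [Nonempty V] {f g : DisjointPair V → ℝ} {c : ℝ} (hc : c ≠ 0)
    (hf : ∀ p, p ≠ emptyPair → 0 ≤ f p) (hg : ∀ p, p ≠ emptyPair → g p = c) (A : Finset V) :
    ∃ lam, IsEigenpair (pairLovaszExt f) (pairLovaszExt g) lam (pairVec (pairLeft A)) := by
  obtain ⟨w, hw, hw0⟩ := exists_mem_convexHull_chainGradient hf A
  have hx := pairVec_ne_zero (pairLeft_ne_emptyPair A)
  set s := pairVec (pairLeft A) with hs
  have hss : ∀ i, s i * s i = 1 := fun i => by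
    by_cases hi : i ∈ A
    · rw [hs, pairVec_pairLeft_of_mem hi]; norm_num
    · rw [hs, pairVec_pairLeft_of_notMem hi]; norm_num
  have hwF : w ∈ clarkeSubdiff (pairLovaszExt f) s := by
    refine convexHull_min ?_ convex_clarkeSubdiff hw
    rintro _ ⟨r, rfl⟩
    exact chainGradient_mem_clarkeSubdiff f A r
  set κ := ∑ i, s i * w i with hκ
  have hκ0 : 0 ≤ κ := Finset.sum_nonneg fun i _ => hw0 i
  rcases hκ0.eq_or_lt with h0 | hpos
  · have hwz : w = 0 := by
      ext i
      have h1 := (Finset.sum_eq_zero_iff_of_nonneg fun i _ => hw0 i).1 h0.symm i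
        (Finset.mem_univ i)
      calc w i = (s i * s i) * w i := by rw [hss, one_mul]
        _ = s i * (s i * w i) := by ring
        _ = 0 := by rw [h1, mul_zero]
    obtain ⟨i⟩ := ‹Nonempty V›
    refine ⟨0, isEigenpair_of_mem hx ?_ (single_mem_clarkeSubdiff hg A i)⟩
    rw [zero_smul, ← hwz]
    exact hwF
  · -- normalised, `w` is a convex combination of the vectors `s i * e i`
    have hv : ∑ i, (s i * w i / κ) • (Pi.single i (c * s i) : V → ℝ) ∈
        clarkeSubdiff (pairLovaszExt g) s := by
      refine convex_clarkeSubdiff.sum_mem (fun i _ => div_nonneg (hw0 i) hpos.le) ?_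
        fun i _ => single_mem_clarkeSubdiff hg A i
      rw [← Finset.sum_div, div_self hpos.ne']
    refine ⟨κ / c, isEigenpair_of_mem hx ?_ hv⟩
    convert hwF using 1
    ext j
    simp only [Pi.smul_apply, Finset.sum_apply, smul_eq_mul]
    rw [Finset.sum_eq_single j (fun i _ hij => by simp [Ne.symm hij]) (by simp),
      Pi.single_eq_same]
    calc κ / c * (s j * w j / κ * (c * s j)) = (s j * s j) * w j := by field_simp
      _ = w j := by rw [hss, one_mul]

end ChainGradients

/-! ### Sums over the two members of a disjoint pair -/

section PairSums

open Filter MeasureTheory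

variable {V : Type*} [Fintype V] [DecidableEq V] {f g : Finset V → ℝ}

theorem integral_upperLevel_congr (h0 : g ∅ = 0) {x : V → ℝ} {a M N : ℝ} (hM : ∀ i, x i ≤ M)
    (hN : ∀ i, x i ≤ N) :
    ∫ t in a..M, g (upperLevel x t) = ∫ t in a..N, g (upperLevel x t) := by
  wlog hMN : M ≤ N generalizing M N
  · exact (this hN hM (le_of_not_ge hMN)).symm
  rw [← intervalIntegral.integral_add_adjacent_intervals
    (intervalIntegrable_upperLevel g x a M) (intervalIntegrable_upperLevel g x M N),
    integral_const_Ioo (k := 0) hMN, mul_zero, add_zero]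
  intro t ht _
  rw [show upperLevel x t = ∅ from Finset.filter_eq_empty_iff.2 fun i _ => by
    have := hM i; linarith, h0]

theorem pairLovaszExt_pairSum (g : Finset V → ℝ) (x : V → ℝ) :
    pairLovaszExt (pairSum g) x =
      (∫ t in (0 : ℝ)..‖x‖, g (upperLevel x t)) + ∫ t in (0 : ℝ)..‖x‖, g (upperLevel (-x) t) := by
  rw [← intervalIntegral.integral_add (intervalIntegrable_upperLevel g x _ _)
    (intervalIntegrable_upperLevel g (-x) _ _), pairLovaszExt]
  refine integral_congr_Ioo (norm_nonneg x) fun t ht _ => ?_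
  simp [pairSum, levelPair, max_eq_left ht.le]

theorem pairLovaszExt_pairSum_neg (g : Finset V → ℝ) (x : V → ℝ) :
    pairLovaszExt (pairSum g) (-x) = pairLovaszExt (pairSum g) x := by
  rw [pairLovaszExt_pairSum, pairLovaszExt_pairSum, norm_neg, neg_neg, add_comm]

theorem pairLovaszExt_pairSum_add_const (h0 : g ∅ = 0) (x : V → ℝ) {t : ℝ} (ht : 0 ≤ t) :
    pairLovaszExt (pairSum g) (x + fun _ => t) = pairLovaszExt (pairSum g) x +
      ((∫ s in (-t)..0, g (upperLevel x s)) - ∫ s in (0 : ℝ)..t, g (upperLevel (-x) s)) := by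
  have hb := fun j => abs_le.1 (abs_apply_le_norm x j)
  have hn := norm_nonneg x
  set y : V → ℝ := x + fun _ => t with hy
  have hyi : ∀ i, y i = x i + t := fun i => rfl
  have hby := fun j => abs_le.1 (abs_apply_le_norm y j)
  have e1 : ∫ s in (0 : ℝ)..‖y‖, g (upperLevel y s) =
      ∫ s in (-t)..‖x‖, g (upperLevel x s) := by
    rw [integral_upperLevel_congr h0 (N := ‖x‖ + t) (fun i => (hby i).2)
      fun i => by rw [hyi]; linarith [hb i]]
    have h := intervalIntegral.integral_comp_add_right (a := -t) (b := ‖x‖)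
      (fun s => g (upperLevel y s)) t
    rw [neg_add_cancel] at h
    rw [← h]
    congr 1
    ext s
    congr 1
    ext i
    simp [hyi]
  have e2 : ∫ s in (0 : ℝ)..‖y‖, g (upperLevel (-y) s) =
      ∫ s in t..‖x‖, g (upperLevel (-x) s) := by
    rw [integral_upperLevel_congr h0 (N := ‖x‖)
      (fun i => by rw [Pi.neg_apply]; linarith [hby i])
      fun i => by rw [Pi.neg_apply, hyi]; linarith [hb i],
      integral_upperLevel_congr (x := -x) h0 (M := ‖x‖) (N := ‖x‖ + t)
      (fun i => by rw [Pi.neg_apply]; linarith [hb i])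
      fun i => by rw [Pi.neg_apply]; linarith [hb i]]
    have h := intervalIntegral.integral_comp_add_right (a := 0) (b := ‖x‖)
      (fun s => g (upperLevel (-x) s)) t
    rw [zero_add] at h
    rw [← h]
    congr 1
    ext s
    congr 1
    ext i
    simp only [mem_upperLevel, Pi.neg_apply, hyi]
    constructor <;> intro _ <;> linarith
  rw [pairLovaszExt_pairSum, pairLovaszExt_pairSum, e1, e2,
    ← intervalIntegral.integral_add_adjacent_intervals (intervalIntegrable_upperLevel g x (-t) 0)
      (intervalIntegrable_upperLevel g x 0 ‖x‖),
    ← intervalIntegral.integral_add_adjacent_intervals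
      (intervalIntegrable_upperLevel g (-x) 0 t) (intervalIntegrable_upperLevel g (-x) t ‖x‖)]
  ring

theorem pairLovaszExt_pairSum_sub_const (h0 : g ∅ = 0) (x : V → ℝ) {t : ℝ} (ht : 0 ≤ t) :
    pairLovaszExt (pairSum g) (x - fun _ => t) = pairLovaszExt (pairSum g) x +
      ((∫ s in (-t)..0, g (upperLevel (-x) s)) - ∫ s in (0 : ℝ)..t, g (upperLevel x s)) := by
  have h := pairLovaszExt_pairSum_add_const h0 (-x) ht
  rw [pairLovaszExt_pairSum_neg, neg_neg] at h
  rw [← h, ← pairLovaszExt_pairSum_neg, neg_sub, sub_eq_neg_add]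

/-- For a symmetric function the two families of level sets form the single family of all upper
level sets, whose integral does not change under translation by constants. -/
theorem pairLovaszExt_pairSum_translate (h0 : f ∅ = 0) (hsymm : ∀ A, f A = f Aᶜ) (x : V → ℝ)
    (c : ℝ) : pairLovaszExt (pairSum f) (x + fun _ => c) = pairLovaszExt (pairSum f) x := by
  wlog hc : 0 ≤ c generalizing c x
  · have h := this (x + fun _ => c) (-c) (by linarith)
    rw [← h]
    congr 1
    ext i
    simp
  rw [pairLovaszExt_pairSum_add_const h0 x hc]
  have e : ∫ s in (0 : ℝ)..c, f (upperLevel (-x) s) = ∫ s in (-c)..0, f (upperLevel x s) := by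
    have h := intervalIntegral.integral_comp_neg (a := 0) (b := c)
      (fun t => f (upperLevel x t))
    rw [neg_zero] at h
    rw [← h]
    refine intervalIntegral.integral_congr_ae ?_
    have hfin : (Set.range fun i => -x i).Countable := (Set.finite_range _).countable
    filter_upwards [hfin.ae_notMem volume] with t ht _
    rw [hsymm]
    congr 1
    ext i
    have hi : t ≠ -x i := fun h => ht ⟨i, h.symm⟩
    simp only [Finset.mem_compl, mem_upperLevel, Pi.neg_apply, not_lt]
    constructor
    · intro h
      have := lt_of_le_of_ne h hi.symm
      linarith
    · intro h; linarith
  rw [e]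
  ring

theorem pairSum_pos (h0 : g ∅ = 0) (hpos : ∀ A : Finset V, A ≠ ∅ → 0 < g A)
    {p : DisjointPair V} (hp : p ≠ emptyPair) : 0 < pairSum g p := by
  have hn : ∀ A : Finset V, 0 ≤ g A := fun A => by
    by_cases hA : A = ∅
    · rw [hA, h0]
    · exact (hpos A hA).le
  obtain ⟨i, hi | hi⟩ := exists_mem_of_ne_emptyPair hp
  · exact add_pos_of_pos_of_nonneg (hpos _ (Finset.ne_empty_of_mem hi)) (hn _)
  · exact add_pos_of_nonneg_of_pos (hn _) (hpos _ (Finset.ne_empty_of_mem hi))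

theorem pairLovaszExt_pairSum_pos (h0 : g ∅ = 0) (hpos : ∀ A : Finset V, A ≠ ∅ → 0 < g A)
    {x : V → ℝ} (hx : x ≠ 0) : 0 < pairLovaszExt (pairSum g) x :=
  intervalIntegral.intervalIntegral_pos_of_pos_on (intervalIntegrable_levelPair _ x _ _)
    (fun _ ht => pairSum_pos h0 hpos (levelPair_ne_emptyPair ht.1.le ht.2))
    (norm_pos_iff.2 hx)

/-! ### IsBalancedVec vectors -/

/-- `x` is balanced with respect to `g` if zero is a median of `x`: neither the positive nor the
negative part of `V` outweighs its complement. -/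
def IsBalancedVec (g : Finset V → ℝ) (x : V → ℝ) : Prop :=
  g (upperLevel x 0) ≤ g (upperLevel x 0)ᶜ ∧ g (upperLevel (-x) 0) ≤ g (upperLevel (-x) 0)ᶜ

theorem IsBalancedVec.neg {x : V → ℝ} (h : IsBalancedVec g x) : IsBalancedVec g (-x) :=
  ⟨h.2, by rw [neg_neg]; exact h.1⟩

theorem IsBalancedVec.le_add_const {x : V → ℝ} (h : IsBalancedVec g x) (h0 : g ∅ = 0)
    (hg : Monotone g) {t : ℝ} (ht : 0 ≤ t) :
    pairLovaszExt (pairSum g) x ≤ pairLovaszExt (pairSum g) (x + fun _ => t) := by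
  rw [pairLovaszExt_pairSum_add_const h0 x ht]
  have h1 : (∫ _ in (-t)..0, g (upperLevel (-x) 0)ᶜ) ≤ ∫ s in (-t)..0, g (upperLevel x s) := by
    refine intervalIntegral.integral_mono_on_of_le_Ioo (by linarith) (by simp)
      (intervalIntegrable_upperLevel g x _ _) fun s hs => hg fun i hi => ?_
    have hs := hs.2
    simp only [Finset.mem_compl, mem_upperLevel, Pi.neg_apply, not_lt] at hi ⊢
    linarith
  have h2 : (∫ s in (0 : ℝ)..t, g (upperLevel (-x) s)) ≤
      ∫ _ in (0 : ℝ)..t, g (upperLevel (-x) 0) := by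
    refine intervalIntegral.integral_mono_on_of_le_Ioo ht
      (intervalIntegrable_upperLevel g _ _ _) (by simp) fun s hs => hg fun i hi => ?_
    have hs := hs.1
    simp only [mem_upperLevel, Pi.neg_apply] at hi ⊢
    linarith
  simp only [intervalIntegral.integral_const, smul_eq_mul, sub_neg_eq_add, zero_add,
    sub_zero] at h1 h2
  have := mul_le_mul_of_nonneg_left h.2 ht
  linarith

theorem IsBalancedVec.le_sub_const {x : V → ℝ} (h : IsBalancedVec g x) (h0 : g ∅ = 0)
    (hg : Monotone g) (t : ℝ) :
    pairLovaszExt (pairSum g) x ≤ pairLovaszExt (pairSum g) (fun i => x i - t) := by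
  rcases le_total t 0 with ht | ht
  · have h1 := h.le_add_const h0 hg (neg_nonneg.2 ht)
    have e : (x + fun _ => -t) = fun i => x i - t := by ext i; simp [sub_eq_add_neg]
    rwa [e] at h1
  · have h1 := h.neg.le_add_const h0 hg ht
    have e : (-x + fun _ => t) = -fun i => x i - t := by ext i; simp; ring
    rwa [e, pairLovaszExt_pairSum_neg, pairLovaszExt_pairSum_neg] at h1

/-- The median is the least entry of `x` above which `g` has at most half its weight. -/
theorem exists_balanced_sub_const [Nonempty V] (h0 : g ∅ = 0) (hg : Monotone g) (x : V → ℝ) :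
    ∃ t, IsBalancedVec g fun i => x i - t := by
  have hn : ∀ A, 0 ≤ g A := fun A => h0 ▸ hg (Finset.empty_subset A)
  set T : Finset V := {i | g (upperLevel x (x i)) ≤ g (upperLevel x (x i))ᶜ} with hT
  have hTne : T.Nonempty := by
    obtain ⟨i, hi⟩ := Finite.exists_max x
    refine ⟨i, ?_⟩
    rw [hT, Finset.mem_filter,
      show upperLevel x (x i) = ∅ from Finset.filter_eq_empty_iff.2 fun j _ => (hi j).not_gt, h0]
    exact ⟨Finset.mem_univ i, hn _⟩
  obtain ⟨i, hi, hmin⟩ := T.exists_min_image x hTne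
  refine ⟨x i, ?_, ?_⟩
  · have e : upperLevel (fun j => x j - x i) 0 = upperLevel x (x i) := by
      ext j; simp
    rw [e]
    exact (Finset.mem_filter.1 hi).2
  · have e : upperLevel (-fun j => x j - x i) 0 = ({j | x j < x i} : Finset V) := by
      ext j; simp
    rw [e]
    rcases ({j | x j < x i} : Finset V).eq_empty_or_nonempty with h | h
    · rw [h, h0]
      exact hn _
    -- compare with the largest entry below the median
    obtain ⟨k, hk, hmax⟩ := Finset.exists_max_image _ x h
    have hk := (Finset.mem_filter.1 hk).2
    have hkT : k ∉ T := fun hkT => (hmin k hkT).not_gt hk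
    have hlt : g (upperLevel x (x k))ᶜ < g (upperLevel x (x k)) := by
      rw [hT, Finset.mem_filter] at hkT
      simpa using hkT
    have e2 : upperLevel x (x k) = ({j | x j < x i} : Finset V)ᶜ := by
      ext j
      simp only [mem_upperLevel, Finset.mem_compl, Finset.mem_filter, Finset.mem_univ, true_and,
        not_lt]
      constructor
      · intro hj
        by_contra! hji
        exact (hmax j (by simpa using hji)).not_gt hj
      · exact fun hj => hk.trans_le hj
    rw [e2, compl_compl] at hlt
    exact hlt.le

theorem IsBalancedVec.apply_upperLevel_le {x : V → ℝ} (h : IsBalancedVec g x) (hg : Monotone g)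
    {t : ℝ} (ht : 0 ≤ t) : g (upperLevel x t) ≤ g (upperLevel x t)ᶜ := by
  have h1 : upperLevel x t ⊆ upperLevel x 0 := fun i hi => by
    rw [mem_upperLevel] at hi ⊢
    linarith
  exact (hg h1).trans (h.1.trans (hg (Finset.compl_subset_compl.2 h1)))

/-- The upper level sets of a balanced vector are the lighter ones of their cuts, so the
isoperimetric inequality bounds `f` by `g` on them. -/
theorem IsBalancedVec.mul_pairSum_le {x : V → ℝ} (h : IsBalancedVec g x) (hg : Monotone g) {c : ℝ}
    (hc : ∀ A, c * min (g A) (g Aᶜ) ≤ f A) {t : ℝ} (ht : 0 ≤ t) :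
    c * pairSum g (levelPair x t) ≤ pairSum f (levelPair x t) := by
  have h1 := hc (upperLevel x t)
  have h2 := hc (upperLevel (-x) t)
  rw [min_eq_left (h.apply_upperLevel_le hg ht)] at h1
  rw [min_eq_left (h.neg.apply_upperLevel_le hg ht)] at h2
  simp only [pairSum, levelPair, max_eq_left ht]
  linarith

theorem mul_pairLovaszExt_le {f g : DisjointPair V → ℝ} {x : V → ℝ} {c : ℝ}
    (h : ∀ t, 0 ≤ t → c * g (levelPair x t) ≤ f (levelPair x t)) :
    c * pairLovaszExt g x ≤ pairLovaszExt f x := by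
  rw [pairLovaszExt, pairLovaszExt, ← intervalIntegral.integral_const_mul]
  exact intervalIntegral.integral_mono_on (norm_nonneg x)
    ((intervalIntegrable_levelPair g x _ _).const_mul c) (intervalIntegrable_levelPair f x _ _)
    fun t ht => h t ht.1

/-- Both one-sided derivatives of `g^L` along constants have to admit the value `⟨v, 1⟩ = 0`. -/
theorem balanced_of_mem_clarkeSubdiff (h0 : g ∅ = 0) (hg : Monotone g) {x v : V → ℝ}
    (hv : v ∈ clarkeSubdiff (pairLovaszExt (pairSum g)) x) (hv0 : v ⬝ᵥ (fun _ => 1) = 0) :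
    IsBalancedVec g x := by
  have hc : ∀ i, Continuous fun y : V → ℝ => y i := continuous_apply
  have hev : ∀ᶠ q : (V → ℝ) × ℝ in 𝓝 x ×ˢ 𝓝[>] (0 : ℝ), 0 < q.2 ∧
      ∀ i, (x i < 0 → q.1 i < -q.2) ∧ (0 < x i → q.2 < q.1 i) := by
    refine (tendsto_snd.eventually self_mem_nhdsWithin).and (eventually_all.2 fun i => ?_)
    have h2 : Tendsto (fun q : (V → ℝ) × ℝ => q.2) (𝓝 x ×ˢ 𝓝[>] (0 : ℝ)) (𝓝 0) :=
      tendsto_snd.mono_right nhdsWithin_le_nhds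
    have h1 : Tendsto (fun q : (V → ℝ) × ℝ => q.1 i) (𝓝 x ×ˢ 𝓝[>] (0 : ℝ)) (𝓝 (x i)) :=
      ((hc i).tendsto x).comp tendsto_fst
    refine Eventually.and ?_ ?_
    · by_cases hi : x i < 0
      · have h3 := h2.neg
        rw [neg_zero] at h3
        filter_upwards [h1.eventually_lt h3 hi] with q hq _ using hq
      · exact Eventually.of_forall fun _ h => absurd h hi
    · by_cases hi : 0 < x i
      · filter_upwards [h2.eventually_lt h1 hi] with q hq _ using hq
      · exact Eventually.of_forall fun _ h => absurd h hi
  constructor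
  · have hle : v ⬝ᵥ (fun _ => (-1 : ℝ)) ≤ g (upperLevel x 0)ᶜ - g (upperLevel x 0) := by
      refine dotProduct_le_of_mem_clarkeSubdiff hv ?_
      filter_upwards [hev] with q ⟨hq, hqi⟩
      have e : q.1 + q.2 • (fun _ => (-1 : ℝ)) = q.1 - fun _ => q.2 := by
        ext i; simp [sub_eq_add_neg]
      rw [e, pairLovaszExt_pairSum_sub_const h0 _ hq.le]
      have k1 : (∫ s in (-q.2)..0, g (upperLevel (-q.1) s)) ≤
          ∫ _ in (-q.2)..0, g (upperLevel x 0)ᶜ := by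
        refine intervalIntegral.integral_mono_on_of_le_Ioo (by linarith)
          (intervalIntegrable_upperLevel g _ _ _) (by simp) fun s hs => hg fun i hi => ?_
        have hs := hs.1
        simp only [Finset.mem_compl, mem_upperLevel, Pi.neg_apply, not_lt] at hi ⊢
        by_contra! hxi
        have := (hqi i).2 hxi
        linarith
      have k2 : (∫ _ in (0 : ℝ)..q.2, g (upperLevel x 0)) ≤
          ∫ s in (0 : ℝ)..q.2, g (upperLevel q.1 s) := by
        refine intervalIntegral.integral_mono_on_of_le_Ioo hq.le (by simp)
          (intervalIntegrable_upperLevel g _ _ _) fun s hs => hg fun i hi => ?_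
        have hs := hs.2
        simp only [mem_upperLevel] at hi ⊢
        have := (hqi i).2 hi
        linarith
      simp only [intervalIntegral.integral_const, smul_eq_mul, sub_neg_eq_add, zero_add,
        sub_zero] at k1 k2
      linarith
    have e : (fun _ : V => (-1 : ℝ)) = -fun _ => 1 := rfl
    rw [e, dotProduct_neg, hv0] at hle
    linarith
  · have hle : v ⬝ᵥ (fun _ => (1 : ℝ)) ≤ g (upperLevel (-x) 0)ᶜ - g (upperLevel (-x) 0) := by
      refine dotProduct_le_of_mem_clarkeSubdiff hv ?_
      filter_upwards [hev] with q ⟨hq, hqi⟩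
      have e : q.1 + q.2 • (fun _ => (1 : ℝ)) = q.1 + fun _ => q.2 := by
        ext i; simp
      rw [e, pairLovaszExt_pairSum_add_const h0 _ hq.le]
      have k1 : (∫ s in (-q.2)..0, g (upperLevel q.1 s)) ≤
          ∫ _ in (-q.2)..0, g (upperLevel (-x) 0)ᶜ := by
        refine intervalIntegral.integral_mono_on_of_le_Ioo (by linarith)
          (intervalIntegrable_upperLevel g _ _ _) (by simp) fun s hs => hg fun i hi => ?_
        have hs := hs.1
        simp only [Finset.mem_compl, mem_upperLevel, Pi.neg_apply, not_lt] at hi ⊢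
        by_contra! hxi
        have := (hqi i).1 (by linarith)
        linarith
      have k2 : (∫ _ in (0 : ℝ)..q.2, g (upperLevel (-x) 0)) ≤
          ∫ s in (0 : ℝ)..q.2, g (upperLevel (-q.1) s) := by
        refine intervalIntegral.integral_mono_on_of_le_Ioo hq.le (by simp)
          (intervalIntegrable_upperLevel g _ _ _) fun s hs => hg fun i hi => ?_
        have hs := hs.2
        simp only [mem_upperLevel, Pi.neg_apply] at hi ⊢
        have := (hqi i).1 (by linarith)
        linarith
      simp only [intervalIntegral.integral_const, smul_eq_mul, sub_neg_eq_add, zero_add,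
        sub_zero] at k1 k2
      linarith
    rw [hv0] at hle
    linarith

/-! ### Eigenvectors below the isoperimetric constant -/

theorem dotProduct_one_eq_zero (h0 : f ∅ = 0) (hsymm : ∀ A, f A = f Aᶜ) {x u : V → ℝ}
    (hu : u ∈ clarkeSubdiff (pairLovaszExt (pairSum f)) x) : u ⬝ᵥ (fun _ => 1) = 0 := by
  refine IsLinearAlong.dotProduct_eq (F := pairLovaszExt (pairSum f)) (x := x) ?_ hu
  refine Eventually.of_forall fun y c _ => ?_
  have e : y + c • (fun _ => (1 : ℝ)) = y + fun _ => c := by ext i; simp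
  rw [e, pairLovaszExt_pairSum_translate h0 hsymm, mul_zero, add_zero]

/-- A nonzero eigenvalue makes the eigenvector balanced, and then the isoperimetric inequality holds
on each of its level pairs. The eigenvalue zero makes `f` vanish on the level pairs, which must then
be trivial. -/
theorem IsEigenpair.eq_const_of_lt (hf0 : f ∅ = 0) (hsymm : ∀ A, f A = f Aᶜ)
    (hf : ∀ A, 0 ≤ f A) (hg0 : g ∅ = 0) (hpos : ∀ A : Finset V, A ≠ ∅ → 0 < g A)
    (hg : Monotone g) {c : ℝ} (hc : ∀ A, c * min (g A) (g Aᶜ) ≤ f A) {lam : ℝ} {x : V → ℝ}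
    (h : IsEigenpair (pairLovaszExt (pairSum f)) (pairLovaszExt (pairSum g)) lam x)
    (hlam : lam < c) : ∃ a, x = fun _ => a := by
  have hx0 : 0 < ‖x‖ := norm_pos_iff.2 h.1
  have hlev := fun t (ht : 0 ≤ t) (htx : t < ‖x‖) => (h.at_levelPair ht htx).1
  by_cases hl : lam = 0
  · have htriv : ∀ A, f A ≤ 0 → A = ∅ ∨ A = Finset.univ := by
      intro A hA
      by_contra! hne
      have h1 : 0 < min (g A) (g Aᶜ) :=
        lt_min (hpos A hne.1.ne_empty) (hpos _ fun he => hne.2 ((Finset.compl_eq_empty_iff A).1 he))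
      have h2 := hc A
      have h3 := mul_pos (hl ▸ hlam) h1
      linarith
    have hzero : ∀ t, 0 ≤ t → t < ‖x‖ → f (upperLevel x t) ≤ 0 ∧ f (upperLevel (-x) t) ≤ 0 := by
      intro t ht htx
      have h1 := hlev t ht htx
      rw [hl, zero_mul] at h1
      simp only [pairSum, levelPair, max_eq_left ht] at h1
      have h2 := hf (upperLevel x t)
      have h3 := hf (upperLevel (-x) t)
      exact ⟨by linarith, by linarith⟩
    -- an upper level set below the top level contains the top entry, hence is everything
    have hconst : ∀ z : V → ℝ, (∀ t, 0 ≤ t → t < ‖x‖ → f (upperLevel z t) ≤ 0) →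
        (∃ i, z i = ‖x‖) → ∀ j, ‖x‖ ≤ z j := by
      intro z hz ⟨i, hi⟩ j
      by_contra! hj
      have ht : max (z j) 0 < ‖x‖ := max_lt hj hx0
      rcases htriv _ (hz _ (le_max_right _ _) ht) with he | he
      · have : i ∈ upperLevel z (max (z j) 0) := mem_upperLevel.2 (hi ▸ ht)
        rw [he] at this
        exact Finset.notMem_empty i this
      · have : j ∈ upperLevel z (max (z j) 0) := he ▸ Finset.mem_univ j
        exact (mem_upperLevel.1 this).not_ge (le_max_left _ _)
    have hne : Nonempty V := by
      obtain ⟨i, -⟩ := Function.ne_iff.1 h.1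
      exact ⟨i⟩
    obtain ⟨i, hi⟩ := exists_abs_eq_norm x
    have hb := fun j => abs_le.1 (abs_apply_le_norm x j)
    rcases abs_choice (x i) with e | e
    · refine ⟨‖x‖, funext fun j => le_antisymm (hb j).2 ?_⟩
      exact hconst x (fun t h1 h2 => (hzero t h1 h2).1) ⟨i, by rw [← hi, e]⟩ j
    · refine ⟨-‖x‖, funext fun j => le_antisymm ?_ (hb j).1⟩
      have := hconst (-x) (fun t h1 h2 => (hzero t h1 h2).2) ⟨i, by rw [← hi, e]; rfl⟩ j
      rw [Pi.neg_apply] at this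
      linarith
  · exfalso
    obtain ⟨-, u, hu, w, ⟨v, hv, rfl⟩, huv⟩ := h
    have huv : u = lam • v := sub_eq_zero.1 huv
    have h1 := dotProduct_one_eq_zero hf0 hsymm hu
    rw [huv, smul_dotProduct, smul_eq_mul] at h1
    have hbal := balanced_of_mem_clarkeSubdiff hg0 hg hv ((mul_eq_zero.1 h1).resolve_left hl)
    have h2 := hbal.mul_pairSum_le hg hc le_rfl
    rw [hlev 0 le_rfl hx0] at h2
    have h3 := pairSum_pos hg0 hpos (levelPair_ne_emptyPair le_rfl hx0)
    nlinarith

/-! ### Subgradients from the greedy algorithm -/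

omit [Fintype V] in
/-- The greedy vector of a nondecreasing submodular function: a nonnegative modular function
below `g` that agrees with `g` on `T`. -/
theorem exists_greedy (h0 : g ∅ = 0) (hg : Monotone g) (hsub : IsSubmodular g) (T : Finset V) :
    ∃ w : V → ℝ, (∀ i, 0 ≤ w i) ∧ (∀ i ∉ T, w i = 0) ∧ (∀ S, ∑ i ∈ S, w i ≤ g S) ∧
      ∑ i ∈ T, w i = g T := by
  induction T using Finset.induction_on with
  | empty =>
    refine ⟨0, by simp, by simp, fun S => ?_, by simp [h0]⟩
    simpa using h0 ▸ hg (Finset.empty_subset S)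
  | insert a T ha ih =>
    obtain ⟨w, hw0, hwT, hwS, hw⟩ := ih
    have hupd : ∀ S, a ∉ S → ∑ i ∈ S, Function.update w a (g (insert a T) - g T) i =
        ∑ i ∈ S, w i := fun S hS =>
      Finset.sum_congr rfl fun i hi => Function.update_of_ne (fun e => hS (by rwa [← e])) _ _
    refine ⟨Function.update w a (g (insert a T) - g T), fun i => ?_, fun i hi => ?_,
      fun S => ?_, ?_⟩
    · by_cases hi : i = a
      · subst hi
        rw [Function.update_self]
        exact sub_nonneg.2 (hg (Finset.subset_insert _ _))
      · rw [Function.update_of_ne hi]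
        exact hw0 i
    · rw [Finset.mem_insert, not_or] at hi
      rw [Function.update_of_ne hi.1, hwT i hi.2]
    · by_cases haS : a ∈ S
      · rw [← Finset.add_sum_erase S _ haS, Function.update_self,
          hupd _ (Finset.notMem_erase a S)]
        have e1 : ∑ i ∈ S.erase a, w i = ∑ i ∈ S ∩ T, w i := by
          symm
          refine Finset.sum_subset (fun i hi => ?_) fun i hi hi2 => hwT i fun hiT => hi2 ?_
          · rw [Finset.mem_inter] at hi
            exact Finset.mem_erase.2 ⟨fun e => ha (e ▸ hi.2), hi.1⟩
          · exact Finset.mem_inter.2 ⟨Finset.mem_of_mem_erase hi, hiT⟩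
        have h1 := hsub (insert a (S ∩ T)) T
        rw [Finset.insert_union, Finset.union_eq_right.2 Finset.inter_subset_right,
          Finset.insert_inter_of_notMem ha, Finset.inter_assoc, Finset.inter_self] at h1
        have h2 : g (insert a (S ∩ T)) ≤ g S :=
          hg (Finset.insert_subset haS Finset.inter_subset_left)
        have h3 := hwS (S ∩ T)
        rw [e1]
        linarith
      · rw [hupd S haS]
        exact hwS S
    · rw [Finset.sum_insert ha, Function.update_self, hupd T ha, hw]
      ring

/-- Layer-cake form of `⟨v, x⟩`, bounded level by level. -/
theorem dotProduct_le_pairLovaszExt {v : V → ℝ} (h1 : ∀ S, ∑ i ∈ S, v i ≤ g S)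
    (h2 : ∀ S, -∑ i ∈ S, v i ≤ g S) (x : V → ℝ) : v ⬝ᵥ x ≤ pairLovaszExt (pairSum g) x := by
  have hb := fun j => abs_le.1 (abs_apply_le_norm x j)
  have e1 := integral_sum_upperLevel v x (fun i => (hb i).2) (norm_nonneg x)
  have e2 := integral_sum_upperLevel (fun i => -v i) (-x)
    (fun i => by rw [Pi.neg_apply]; linarith [hb i]) (norm_nonneg x)
  have e : v ⬝ᵥ x = ∑ i, v i * max (x i) 0 + ∑ i, -v i * max ((-x) i) 0 := by
    rw [← Finset.sum_add_distrib]
    refine Finset.sum_congr rfl fun i _ => ?_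
    rcases le_total (x i) 0 with h | h
    · rw [max_eq_right h, Pi.neg_apply, max_eq_left (by linarith)]
      ring
    · rw [max_eq_left h, Pi.neg_apply, max_eq_right (by linarith)]
      ring
  rw [e, ← e1, ← e2, pairLovaszExt_pairSum]
  refine add_le_add ?_ ?_
  · exact intervalIntegral.integral_mono_on (norm_nonneg x)
      (intervalIntegrable_upperLevel (fun S => ∑ i ∈ S, v i) x _ _)
      (intervalIntegrable_upperLevel g x _ _) fun t _ => h1 _
  · exact intervalIntegral.integral_mono_on (norm_nonneg x)
      (intervalIntegrable_upperLevel (fun S => ∑ i ∈ S, -v i) (-x) _ _)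
      (intervalIntegrable_upperLevel g (-x) _ _) fun t _ => by
        rw [Finset.sum_neg_distrib]; exact h2 _

/-- The pair `(A, ∅)`. -/
def singlePair (A : Finset V) : DisjointPair V := ⟨(A, ∅), Finset.disjoint_empty_right A⟩

omit [Fintype V] in
theorem pairVec_singlePair (A : Finset V) : pairVec (singlePair A) = indVec A := by
  ext i
  simp [pairVec, singlePair, indVec]

omit [Fintype V] [DecidableEq V] in
theorem singlePair_ne_emptyPair {A : Finset V} (hA : A ≠ ∅) : singlePair A ≠ emptyPair :=
  fun h => hA (congrArg (fun p => p.1.1) h)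

theorem upperLevel_indVec (A : Finset V) {t : ℝ} (h0 : 0 ≤ t) (h1 : t < 1) :
    upperLevel (indVec A) t = A := by
  ext i
  by_cases hi : i ∈ A
  · simp [indVec, hi, h1]
  · simp [indVec, hi, h0]

theorem upperLevel_neg_indVec (A : Finset V) {t : ℝ} (h0 : 0 ≤ t) :
    upperLevel (-indVec A) t = ∅ := by
  refine Finset.filter_eq_empty_iff.2 fun i _ => ?_
  by_cases hi : i ∈ A
  · simp [indVec, hi]; linarith
  · simp [indVec, hi, h0]

theorem pairLovaszExt_indVec (h0 : g ∅ = 0) (A : Finset V) :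
    pairLovaszExt (pairSum g) (indVec A) = g A := by
  have hle : ∀ i, indVec A i ≤ 1 := fun i => by
    by_cases hi : i ∈ A <;> simp [indVec, hi]
  rw [pairLovaszExt_pairSum,
    integral_upperLevel_congr h0 (N := 1)
      (fun i => (le_abs_self _).trans (abs_apply_le_norm _ i)) hle,
    integral_const_Ioo (k := g A) zero_le_one fun t h1 h2 => by
      rw [upperLevel_indVec A h1.le h2],
    integral_const_Ioo (k := 0) (norm_nonneg _) fun t h1 _ => by
      rw [upperLevel_neg_indVec A h1.le, h0]]
  ring

theorem dotProduct_indVec (v : V → ℝ) (A : Finset V) : v ⬝ᵥ indVec A = ∑ i ∈ A, v i := by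
  simp [dotProduct, indVec]

theorem indVec_ne_zero {A : Finset V} (hA : A ≠ ∅) : indVec A ≠ 0 := by
  rw [← pairVec_singlePair]
  exact pairVec_ne_zero (singlePair_ne_emptyPair hA)

theorem mem_clarkeSubdiff_indVec (h0 : g ∅ = 0) {v : V → ℝ} (h1 : ∀ S, ∑ i ∈ S, v i ≤ g S)
    (h2 : ∀ S, -∑ i ∈ S, v i ≤ g S) {A : Finset V} (hA : ∑ i ∈ A, v i = g A) :
    v ∈ clarkeSubdiff (pairLovaszExt (pairSum g)) (indVec A) := by
  refine mem_clarkeSubdiff_of_minorant fun y => ?_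
  rw [dotProduct_sub, dotProduct_indVec, pairLovaszExt_indVec h0, hA]
  have := dotProduct_le_pairLovaszExt h1 h2 y
  linarith

theorem isEigenpair_zero [Nonempty V] (hf0 : f ∅ = 0) (hsymm : ∀ A, f A = f Aᶜ)
    (hf : ∀ A, 0 ≤ f A) (hg0 : g ∅ = 0) (hg : Monotone g) (hsub : IsSubmodular g) :
    IsEigenpair (pairLovaszExt (pairSum f)) (pairLovaszExt (pairSum g)) 0
      (indVec Finset.univ) := by
  obtain ⟨w, hw0, -, hwS, hw⟩ := exists_greedy hg0 hg hsub Finset.univ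
  have hn : ∀ A, 0 ≤ g A := fun A => hg0 ▸ hg (Finset.empty_subset A)
  refine isEigenpair_of_mem (indVec_ne_zero Finset.univ_nonempty.ne_empty) (v := w) ?_
    (mem_clarkeSubdiff_indVec hg0 hwS (fun S => ?_) hw)
  · refine mem_clarkeSubdiff_of_minorant fun y => ?_
    rw [pairLovaszExt_indVec hf0, hsymm, Finset.compl_univ, hf0, zero_smul, zero_dotProduct,
      add_zero]
    exact intervalIntegral.integral_nonneg (norm_nonneg y) fun t _ => add_nonneg (hf _) (hf _)
  · have := Finset.sum_nonneg (s := S) fun i _ => hw0 i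
    linarith [hn S]

/-- A greedy vector on `A`, minus a multiple of one on the complement, is a subgradient of `g^L` at
`1_A` orthogonal to the constants. By the isoperimetric inequality on balanced translates its
multiple by `c` is a minorant of `f^L`, with equality at `1_A`. -/
theorem isEigenpair_indVec [Nonempty V] (hf0 : f ∅ = 0) (hsymm : ∀ A, f A = f Aᶜ)
    (hg0 : g ∅ = 0) (hpos : ∀ A : Finset V, A ≠ ∅ → 0 < g A) (hg : Monotone g)
    (hsub : IsSubmodular g) {c : ℝ} (hc0 : 0 ≤ c) (hc : ∀ A, c * min (g A) (g Aᶜ) ≤ f A)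
    {A : Finset V} (hA : A ≠ ∅) (hle : g A ≤ g Aᶜ) (hfA : f A = c * g A) :
    IsEigenpair (pairLovaszExt (pairSum f)) (pairLovaszExt (pairSum g)) c (indVec A) := by
  obtain ⟨w, hw0, hwA, hwS, hw⟩ := exists_greedy hg0 hg hsub A
  obtain ⟨w', hw'0, hw'A, hw'S, hw'⟩ := exists_greedy hg0 hg hsub Aᶜ
  have hgA := hpos A hA
  have hgA' : 0 < g Aᶜ := hgA.trans_le hle
  set θ := g A / g Aᶜ with hθ
  have hθ0 : 0 ≤ θ := div_nonneg hgA.le hgA'.le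
  have hθ1 : θ ≤ 1 := (div_le_one hgA').2 hle
  set v := w - θ • w' with hv
  have hsum : ∀ S, ∑ i ∈ S, v i = ∑ i ∈ S, w i - θ * ∑ i ∈ S, w' i := by
    intro S
    simp [hv, Finset.sum_sub_distrib, Finset.mul_sum]
  have hn1 := fun S : Finset V => Finset.sum_nonneg (s := S) fun i _ => hw0 i
  have hn2 := fun S : Finset V => Finset.sum_nonneg (s := S) fun i _ => hw'0 i
  have hv1 : ∀ S, ∑ i ∈ S, v i ≤ g S := fun S => by
    rw [hsum]
    have := mul_nonneg hθ0 (hn2 S)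
    linarith [hwS S]
  have hv2 : ∀ S, -∑ i ∈ S, v i ≤ g S := fun S => by
    rw [hsum]
    have := mul_le_of_le_one_left (hn2 S) hθ1
    linarith [hw'S S, hn1 S]
  have hvA : ∑ i ∈ A, v i = g A := by
    rw [hsum, hw, Finset.sum_eq_zero fun i hi => hw'A i (by simpa using hi)]
    ring
  have hvc : v ⬝ᵥ (fun _ => 1) = 0 := by
    have e : v ⬝ᵥ (fun _ => 1) = ∑ i ∈ A, v i + ∑ i ∈ Aᶜ, v i := by
      rw [Finset.sum_add_sum_compl]
      simp [dotProduct]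
    rw [e, hvA, hsum, hw', Finset.sum_eq_zero fun i hi => hwA i (by simpa using hi), hθ,
      div_mul_cancel₀ _ hgA'.ne']
    ring
  refine isEigenpair_of_mem (indVec_ne_zero hA) (v := v) ?_
    (mem_clarkeSubdiff_indVec hg0 hv1 hv2 hvA)
  refine mem_clarkeSubdiff_of_minorant fun y => ?_
  obtain ⟨t, ht⟩ := exists_balanced_sub_const hg0 hg y
  have e : (fun i => y i - t) = y + fun _ => -t := rfl
  have h1 := mul_pairLovaszExt_le fun s hs => ht.mul_pairSum_le hg hc hs
  rw [e, pairLovaszExt_pairSum_translate hf0 hsymm] at h1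
  have h2 := dotProduct_le_pairLovaszExt hv1 hv2 (y + fun _ => -t)
  have e2 : (fun _ : V => -t) = (-t) • fun _ => 1 := by ext i; simp
  rw [dotProduct_add, e2, dotProduct_smul, hvc, smul_zero, add_zero, ← e2] at h2
  have h3 := mul_le_mul_of_nonneg_left h2 hc0
  rw [smul_dotProduct, dotProduct_sub, dotProduct_indVec, hvA, pairLovaszExt_indVec hf0, hfA,
    smul_eq_mul]
  linarith

end PairSums

/-! ### The isoperimetric constant and its characterisations -/

section Isoperimetric

open Filter

variable {V : Type*} [Fintype V] [DecidableEq V] {f g : Finset V → ℝ}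

/-- The ratios `f(A) / min {g(A), g(V \ A)}` of the nontrivial subsets `A`. -/
def cutRatios (f g : Finset V → ℝ) : Set ℝ :=
  {r | ∃ A : Finset V, A ≠ ∅ ∧ A ≠ Finset.univ ∧ r = f A / min (g A) (g Aᶜ)}

theorem min_apply_compl_pos (hpos : ∀ A : Finset V, A ≠ ∅ → 0 < g A) {A : Finset V}
    (h1 : A ≠ ∅) (h2 : A ≠ Finset.univ) : 0 < min (g A) (g Aᶜ) :=
  lt_min (hpos A h1) (hpos _ fun h => h2 ((Finset.compl_eq_empty_iff A).1 h))

theorem exists_isLeast_cutRatios [Nontrivial V] (f g : Finset V → ℝ) :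
    ∃ c, IsLeast (cutRatios f g) c := by
  obtain ⟨i, j, hij⟩ := exists_pair_ne V
  have hfin : (cutRatios f g).Finite :=
    (Set.finite_range fun A : Finset V => f A / min (g A) (g Aᶜ)).subset
      fun r ⟨A, _, _, h⟩ => ⟨A, h.symm⟩
  have hne : (cutRatios f g).Nonempty :=
    ⟨_, {i}, Finset.singleton_ne_empty i,
      fun h => hij (Finset.mem_singleton.1 (h ▸ Finset.mem_univ j)).symm, rfl⟩
  obtain ⟨c, hc, hmin⟩ := Set.exists_min_image _ id hfin hne
  exact ⟨c, hc, fun r hr => hmin r hr⟩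

theorem mul_min_le_of_isLeast (hf0 : f ∅ = 0) (hsymm : ∀ A, f A = f Aᶜ) (hg0 : g ∅ = 0)
    (hpos : ∀ A : Finset V, A ≠ ∅ → 0 < g A) {c : ℝ} (hc : IsLeast (cutRatios f g) c)
    (A : Finset V) : c * min (g A) (g Aᶜ) ≤ f A := by
  have hn : ∀ A, 0 ≤ g A := fun A => by
    by_cases hA : A = ∅
    · rw [hA, hg0]
    · exact (hpos A hA).le
  by_cases h1 : A = ∅
  · rw [h1, hf0, hg0, min_eq_left (hn _), mul_zero]
  by_cases h2 : A = Finset.univ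
  · rw [hsymm, h2, Finset.compl_univ, hf0, hg0, min_eq_right (hn _), mul_zero]
  · rw [← le_div_iff₀ (min_apply_compl_pos hpos h1 h2)]
    exact hc.2 ⟨A, h1, h2, rfl⟩

/-- An optimal cut, with the lighter side chosen. -/
theorem exists_minimizer (hsymm : ∀ A, f A = f Aᶜ) (hpos : ∀ A : Finset V, A ≠ ∅ → 0 < g A)
    {c : ℝ} (hc : IsLeast (cutRatios f g) c) :
    ∃ A : Finset V, A ≠ ∅ ∧ A ≠ Finset.univ ∧ g A ≤ g Aᶜ ∧ f A = c * g A := by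
  obtain ⟨A, h1, h2, hA⟩ := hc.1
  have h3 := min_apply_compl_pos hpos h1 h2
  have h4 : f A = c * min (g A) (g Aᶜ) := by rw [hA, div_mul_cancel₀ _ h3.ne']
  rcases le_total (g A) (g Aᶜ) with h | h
  · exact ⟨A, h1, h2, h, by rw [h4, min_eq_left h]⟩
  · refine ⟨Aᶜ, fun e => h2 ((Finset.compl_eq_empty_iff A).1 e),
      fun e => h1 ((Finset.compl_eq_univ_iff A).1 e), by rwa [compl_compl], ?_⟩
    rw [← hsymm, h4, min_eq_right h]

theorem isoperimetric_nonneg (hf : ∀ A, 0 ≤ f A) (hpos : ∀ A : Finset V, A ≠ ∅ → 0 < g A)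
    {c : ℝ} (hc : IsLeast (cutRatios f g) c) : 0 ≤ c := by
  obtain ⟨A, h1, h2, rfl⟩ := hc.1
  exact div_nonneg (hf A) (min_apply_compl_pos hpos h1 h2).le

theorem isLeast_range_of_balanced (hg0 : g ∅ = 0) (hg : Monotone g) {x : V → ℝ} {t : ℝ}
    (h : IsBalancedVec g fun i => x i - t) :
    IsLeast (Set.range fun t : ℝ => pairLovaszExt (pairSum g) fun i => x i - t)
      (pairLovaszExt (pairSum g) fun i => x i - t) := by
  refine ⟨⟨t, rfl⟩, ?_⟩
  rintro _ ⟨s, rfl⟩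
  have h1 := h.le_sub_const hg0 hg (s - t)
  have e : (fun i => x i - t - (s - t)) = fun i => x i - s := by ext i; ring
  rwa [e] at h1

omit [DecidableEq V] in
theorem sub_const_ne_zero [Nonempty V] {x : V → ℝ} (hx : x ≠ 0) (hsum : ∑ i, x i = 0) (t : ℝ) :
    (fun i => x i - t) ≠ 0 := by
  intro h
  have hxt : ∀ i, x i = t := fun i => sub_eq_zero.1 (congrFun h i)
  have h1 : (Fintype.card V : ℝ) * t = 0 := by
    rw [← hsum, Finset.sum_congr rfl fun i _ => hxt i]
    simp
  have h2 : t = 0 := (mul_eq_zero.1 h1).resolve_left (by simp)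
  exact hx (funext fun i => by rw [hxt i, h2]; rfl)

theorem exists_isLeast_sub_const [Nonempty V] (hg0 : g ∅ = 0)
    (hpos : ∀ A : Finset V, A ≠ ∅ → 0 < g A) (hg : Monotone g) {x : V → ℝ} (hx : x ≠ 0)
    (hsum : ∑ i, x i = 0) : ∃ m : ℝ, 0 < m ∧
      IsLeast (Set.range fun t : ℝ => pairLovaszExt (pairSum g) (fun i => x i - t)) m := by
  obtain ⟨t, ht⟩ := exists_balanced_sub_const hg0 hg x
  exact ⟨_, pairLovaszExt_pairSum_pos hg0 hpos (sub_const_ne_zero hx hsum t),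
    isLeast_range_of_balanced hg0 hg ht⟩

theorem isBalancedVec_indVec (hg : Monotone g) {A : Finset V}
    (hle : g A ≤ g Aᶜ) : IsBalancedVec g (indVec A) := by
  constructor
  · rwa [upperLevel_indVec A le_rfl zero_lt_one]
  · rw [upperLevel_neg_indVec A le_rfl]
    exact hg (Finset.empty_subset _)

theorem isLeast_quotient [Nonempty V] (hf0 : f ∅ = 0) (hsymm : ∀ A, f A = f Aᶜ) (hg0 : g ∅ = 0)
    (hpos : ∀ A : Finset V, A ≠ ∅ → 0 < g A) (hg : Monotone g) {c : ℝ}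
    (hc : IsLeast (cutRatios f g) c) :
    IsLeast {r : ℝ | ∃ (x : V → ℝ) (m : ℝ), x ≠ 0 ∧ ∑ i, x i = 0 ∧
      IsLeast (Set.range fun t : ℝ => pairLovaszExt (pairSum g) (fun i => x i - t)) m ∧
      r = pairLovaszExt (pairSum f) x / m} c := by
  constructor
  · obtain ⟨A, h1, h2, hle, hfA⟩ := exists_minimizer hsymm hpos hc
    -- the indicator vector of an optimal cut, translated to mean zero
    set a : ℝ := (A.card : ℝ) / Fintype.card V with ha
    set x : V → ℝ := indVec A + fun _ => -a with hx
    have hxi : ∀ i, x i = indVec A i + -a := fun i => rfl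
    have e : (fun i => x i - -a) = indVec A := by ext i; rw [hxi]; ring
    have hbal : IsBalancedVec g fun i => x i - -a := by
      rw [e]
      exact isBalancedVec_indVec hg hle
    have hleast := isLeast_range_of_balanced hg0 hg hbal
    rw [e, pairLovaszExt_indVec hg0] at hleast
    refine ⟨x, g A, ?_, ?_, hleast, ?_⟩
    · intro h
      obtain ⟨i, hi⟩ := Finset.nonempty_iff_ne_empty.2 h1
      obtain ⟨j, hj⟩ : ∃ j, j ∉ A := by
        by_contra! hall
        exact h2 (Finset.eq_univ_iff_forall.2 hall)
      have k1 := congrFun h i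
      have k2 := congrFun h j
      simp only [hxi, indVec, hi, hj, if_true, if_false, Pi.zero_apply] at k1 k2
      linarith
    · simp only [hxi, Finset.sum_add_distrib, Finset.sum_const, Finset.card_univ,
        nsmul_eq_mul, ha]
      have k : (Fintype.card V : ℝ) ≠ 0 := by simp
      have k2 : ∑ i, indVec A i = A.card := by simp [indVec]
      rw [k2]
      field_simp
      ring
    · rw [hx, pairLovaszExt_pairSum_translate hf0 hsymm, pairLovaszExt_indVec hf0, hfA,
        mul_div_cancel_right₀ _ (hpos A h1).ne']
  · rintro r ⟨x, m, hx, hsum, hm, rfl⟩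
    obtain ⟨t, ht⟩ := exists_balanced_sub_const hg0 hg x
    have hm' := isLeast_range_of_balanced hg0 hg ht
    have hmpos := pairLovaszExt_pairSum_pos hg0 hpos (sub_const_ne_zero hx hsum t)
    rw [hm.unique hm', le_div_iff₀ hmpos]
    have h1 := mul_pairLovaszExt_le fun s hs =>
      ht.mul_pairSum_le hg (mul_min_le_of_isLeast hf0 hsymm hg0 hpos hc) hs
    have e : (fun i => x i - t) = x + fun _ => -t := rfl
    rw [e, pairLovaszExt_pairSum_translate hf0 hsymm] at h1
    exact h1

/-- Of two disjoint sets at least one is the lighter side of its own cut. -/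
theorem isLeast_max_ratio (hf0 : f ∅ = 0) (hsymm : ∀ A, f A = f Aᶜ) (hf : ∀ A, 0 ≤ f A)
    (hg0 : g ∅ = 0) (hpos : ∀ A : Finset V, A ≠ ∅ → 0 < g A) (hg : Monotone g) {c : ℝ}
    (hc : IsLeast (cutRatios f g) c) :
    IsLeast {r : ℝ | ∃ p : DisjointPair V, p.1.1 ≠ ∅ ∧ p.1.2 ≠ ∅ ∧
      r = max (f p.1.1 / g p.1.1) (f p.1.2 / g p.1.2)} c := by
  have hcut := mul_min_le_of_isLeast hf0 hsymm hg0 hpos hc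
  constructor
  · obtain ⟨A, h1, h2, hle, hfA⟩ := exists_minimizer hsymm hpos hc
    refine ⟨pairLeft A, h1, fun e => h2 ((Finset.compl_eq_empty_iff A).1 e), ?_⟩
    have h3 : f A / g A = c := by rw [hfA, mul_div_cancel_right₀ _ (hpos A h1).ne']
    have h4 : f Aᶜ / g Aᶜ ≤ f A / g A := by
      rw [← hsymm]
      exact div_le_div_of_nonneg_left (hf A) (hpos A h1) hle
    exact (max_eq_left h4 ▸ h3).symm
  · rintro r ⟨⟨⟨A, B⟩, hAB⟩, hA, hB, rfl⟩
    have key : ∀ C : Finset V, C ≠ ∅ → g C ≤ g Cᶜ → c ≤ f C / g C := by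
      intro C hC hle
      have := hcut C
      rwa [min_eq_left hle, ← le_div_iff₀ (hpos C hC)] at this
    rcases le_total (g A) (g Aᶜ) with h | h
    · exact (key A hA h).trans (le_max_left _ _)
    · refine (key B hB ?_).trans (le_max_right _ _)
      have h1 : g B ≤ g Aᶜ := hg (Finset.subset_compl_iff_disjoint_left.2 hAB)
      have h2 : g A ≤ g Bᶜ := hg (Finset.subset_compl_iff_disjoint_right.2 hAB)
      exact h1.trans (h.trans h2)

/-! ### The second eigenvalue counted with multiplicity -/

theorem two_le_finrank_span {S : Set (V → ℝ)} {A : Finset V} (h1 : A ≠ ∅) (h2 : A ≠ Finset.univ)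
    (hA : indVec A ∈ S) (hV : indVec Finset.univ ∈ S) :
    2 ≤ Module.finrank ℝ (Submodule.span ℝ S) := by
  have hli : LinearIndependent ℝ ![indVec Finset.univ, indVec A] := by
    refine LinearIndependent.pair_iff.2 fun s t hst => ?_
    obtain ⟨i, hi⟩ := Finset.nonempty_iff_ne_empty.2 h1
    obtain ⟨j, hj⟩ : ∃ j, j ∉ A := by
      by_contra! hall
      exact h2 (Finset.eq_univ_iff_forall.2 hall)
    have k1 := congrFun hst i
    have k2 := congrFun hst j
    simp [indVec, hi, hj] at k1 k2
    exact ⟨k2, by linarith⟩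
  have hcard := (finrank_span_eq_card hli).trans (Fintype.card_fin 2)
  refine hcard.symm.le.trans (Submodule.finrank_mono (Submodule.span_mono ?_))
  rintro _ ⟨k, rfl⟩
  fin_cases k
  · exact hV
  · exact hA

omit [Fintype V] [DecidableEq V] in
theorem finrank_span_le_one_of_const {S : Set (V → ℝ)} (h : ∀ x ∈ S, ∃ a, x = fun _ => a) :
    Module.finrank ℝ (Submodule.span ℝ S) ≤ 1 := by
  have hle : Submodule.span ℝ S ≤ Submodule.span ℝ {fun _ => (1 : ℝ)} := by
    refine Submodule.span_le.2 fun x hx => ?_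
    obtain ⟨a, rfl⟩ := h x hx
    exact Submodule.mem_span_singleton.2 ⟨a, by ext i; simp⟩
  refine (Submodule.finrank_mono hle).trans ?_
  exact (finrank_span_le_card _).trans (by simp)

section SecondEigenvalue

variable [Nonempty V] (hf0 : f ∅ = 0) (hsymm : ∀ A, f A = f Aᶜ) (hf : ∀ A, 0 ≤ f A)
  (hg0 : g ∅ = 0) (hpos : ∀ A : Finset V, A ≠ ∅ → 0 < g A) (hg : Monotone g)
  (hsub : IsSubmodular g) {c : ℝ} (hc : IsLeast (cutRatios f g) c)

include hf0 hsymm hf hg0 hpos hg hsub hc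

theorem isKthEigenvalue_two :
    IsKthEigenvalue (pairLovaszExt (pairSum f)) (pairLovaszExt (pairSum g)) 2 c := by
  have hcut := mul_min_le_of_isLeast hf0 hsymm hg0 hpos hc
  have hc0 := isoperimetric_nonneg hf hpos hc
  constructor
  · obtain ⟨A, h1, h2, hle, hfA⟩ := exists_minimizer hsymm hpos hc
    have hA := isEigenpair_indVec hf0 hsymm hg0 hpos hg hsub hc0 hcut h1 hle hfA
    exact ⟨⟨_, hA⟩, two_le_finrank_span h1 h2 ⟨c, le_rfl, hA⟩
      ⟨0, hc0, isEigenpair_zero hf0 hsymm hf hg0 hg hsub⟩⟩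
  · rintro lam ⟨-, h2⟩
    by_contra! hlt
    have := h2.trans (finrank_span_le_one_of_const fun x ⟨nu, hnu, hx⟩ =>
      hx.eq_const_of_lt hf0 hsymm hf hg0 hpos hg hcut (hnu.trans_lt hlt))
    omega

theorem isKthSetEigenvalue_two : IsKthSetEigenvalue (pairSum f) (pairSum g) 2 c := by
  have hcut := mul_min_le_of_isLeast hf0 hsymm hg0 hpos hc
  have hc0 := isoperimetric_nonneg hf hpos hc
  constructor
  · obtain ⟨A, h1, h2, hle, hfA⟩ := exists_minimizer hsymm hpos hc
    have hA : IsEigenset (pairSum f) (pairSum g) c (singlePair A) := by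
      refine ⟨singlePair_ne_emptyPair h1, ?_⟩
      rw [pairVec_singlePair]
      exact isEigenpair_indVec hf0 hsymm hg0 hpos hg hsub hc0 hcut h1 hle hfA
    have hV : IsEigenset (pairSum f) (pairSum g) 0 (singlePair Finset.univ) := by
      refine ⟨singlePair_ne_emptyPair Finset.univ_nonempty.ne_empty, ?_⟩
      rw [pairVec_singlePair]
      exact isEigenpair_zero hf0 hsymm hf hg0 hg hsub
    exact ⟨⟨_, hA⟩, two_le_finrank_span h1 h2
      ⟨c, le_rfl, _, hA, (pairVec_singlePair A).symm⟩
      ⟨0, hc0, _, hV, (pairVec_singlePair _).symm⟩⟩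
  · rintro lam ⟨-, h2⟩
    by_contra! hlt
    have := h2.trans (finrank_span_le_one_of_const fun x ⟨nu, hnu, p, hp, hx⟩ =>
      hx ▸ hp.2.eq_const_of_lt hf0 hsymm hf hg0 hpos hg hcut (hnu.trans_lt hlt))
    omega

end SecondEigenvalue

/-! ### The variational eigenvalue -/

theorem isOpen_setOf_apply_compl_lt (hg : Monotone g) :
    IsOpen {x : V → ℝ | g (upperLevel x 0)ᶜ < g (upperLevel x 0)} := by
  refine isOpen_iff_eventually.2 fun x hx => ?_
  have hev : ∀ᶠ y in 𝓝 x, ∀ i, 0 < x i → 0 < y i := by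
    refine eventually_all.2 fun i => ?_
    by_cases hi : 0 < x i
    · filter_upwards [(isOpen_lt continuous_const (continuous_apply i)).mem_nhds hi] with y hy _
        using hy
    · exact Eventually.of_forall fun _ h => absurd h hi
  filter_upwards [hev] with y hy
  have hsub : upperLevel x 0 ⊆ upperLevel y 0 := fun i hi => by
    rw [mem_upperLevel] at hi ⊢
    exact hy i hi
  exact (hg (Finset.compl_subset_compl.2 hsub)).trans_lt (lt_of_lt_of_le hx (hg hsub))

/-- The vectors whose positive side outweighs its complement and the negatives of such vectors form
two disjoint open sets. A set covered by them has an odd continuous map to `{1, -1}`. -/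
theorem exists_balanced_of_genusAtLeast (hg : Monotone g) {S : Set (V → ℝ)}
    (hgen : GenusAtLeast S 2) : ∃ x ∈ S, IsBalancedVec g x := by
  classical
  by_contra! hcon
  set P : Set (V → ℝ) := {x | g (upperLevel x 0)ᶜ < g (upperLevel x 0)} with hP
  have hPo : IsOpen P := isOpen_setOf_apply_compl_lt hg
  have hdisj : ∀ x, x ∈ P → -x ∉ P := by
    intro x h1 h2
    have h1 : g (upperLevel x 0)ᶜ < g (upperLevel x 0) := h1
    have h2 : g (upperLevel (-x) 0)ᶜ < g (upperLevel (-x) 0) := h2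
    have hsub : upperLevel x 0 ⊆ (upperLevel (-x) 0)ᶜ := fun i hi => by
      simp only [Finset.mem_compl, mem_upperLevel, Pi.neg_apply, not_lt] at hi ⊢
      linarith
    have h3 := hg hsub
    have h4 := hg (Finset.subset_compl_comm.1 hsub)
    linarith
  have hcov : ∀ x ∈ S, x ∉ P → -x ∈ P := by
    intro x hx hxP
    by_contra hnP
    exact hcon x hx ⟨not_lt.1 hxP, not_lt.1 hnP⟩
  refine hgen 1 one_lt_two ⟨fun x _ => if (x : V → ℝ) ∈ P then 1 else -1, ?_, ?_, ?_⟩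
  · refine continuous_pi fun _ => ?_
    have hclopen : IsClopen {x : S | (x : V → ℝ) ∈ P} := by
      refine ⟨⟨?_⟩, hPo.preimage continuous_subtype_val⟩
      have e : {x : S | (x : V → ℝ) ∈ P}ᶜ = (fun x : S => -(x : V → ℝ)) ⁻¹' P := by
        ext x
        exact ⟨hcov x x.2, fun h1 h2 => hdisj x h2 h1⟩
      rw [e]
      exact hPo.preimage continuous_subtype_val.neg
    exact continuous_const.if (fun x hx => by
      rw [hclopen.frontier_eq] at hx
      exact absurd hx (Set.notMem_empty x)) continuous_const
  · intro x h
    have := congrFun h 0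
    simp only [Pi.zero_apply] at this
    split_ifs at this <;> norm_num at this
  · intro x y hxy
    ext k
    simp only [Pi.neg_apply, hxy]
    by_cases hx : (x : V → ℝ) ∈ P
    · simp [hx, hdisj _ hx]
    · simp [hx, hcov x x.2 hx]

/-- The image of the unit circle in the plane spanned by `1_A` and `1_{V \ A}`. -/
def cutCircle (A : Finset V) : Set (V → ℝ) :=
  (fun z : ℂ => z.re • indVec A + z.im • indVec Aᶜ) '' Metric.sphere 0 1

theorem continuous_cutPlane (A : Finset V) :
    Continuous fun z : ℂ => z.re • indVec A + z.im • indVec Aᶜ :=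
  (Complex.continuous_re.smul continuous_const).add (Complex.continuous_im.smul continuous_const)

theorem cutPlane_apply_of_mem {A : Finset V} {i : V} (hi : i ∈ A) (z : ℂ) :
    (z.re • indVec A + z.im • indVec Aᶜ) i = z.re := by simp [indVec, hi]

theorem cutPlane_apply_of_notMem {A : Finset V} {i : V} (hi : i ∉ A) (z : ℂ) :
    (z.re • indVec A + z.im • indVec Aᶜ) i = z.im := by simp [indVec, hi]

theorem cutPlane_neg (A : Finset V) (z : ℂ) :
    (-z).re • indVec A + (-z).im • indVec Aᶜ = -(z.re • indVec A + z.im • indVec Aᶜ) := by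
  rw [Complex.neg_re, Complex.neg_im, neg_smul, neg_smul, neg_add]

theorem genusAtLeast_cutCircle (A : Finset V) : GenusAtLeast (cutCircle A) 2 := by
  rintro k hk ⟨φ, hφ, hφ0, hodd⟩
  have hmem : ∀ z : Metric.sphere (0 : ℂ) 1,
      (z : ℂ).re • indVec A + (z : ℂ).im • indVec Aᶜ ∈ cutCircle A := fun z => ⟨z, z.2, rfl⟩
  set z₁ : Metric.sphere (0 : ℂ) 1 := ⟨1, by simp⟩
  set z₂ : Metric.sphere (0 : ℂ) 1 := ⟨-1, by simp⟩
  have hk1 : k = 0 ∨ k = 1 := by omega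
  rcases hk1 with rfl | rfl
  · exact hφ0 ⟨_, hmem z₁⟩ (Subsingleton.elim _ _)
  -- the circle is connected, so an odd real function on it has a zero
  have : PreconnectedSpace (Metric.sphere (0 : ℂ) 1) :=
    Subtype.preconnectedSpace (isPreconnected_sphere (by simp) 0 1)
  set ψ : Metric.sphere (0 : ℂ) 1 → ℝ := fun z => φ ⟨_, hmem z⟩ 0 with hψ
  have hψc : Continuous ψ := (continuous_apply 0).comp
    (hφ.comp (((continuous_cutPlane A).comp continuous_subtype_val).subtype_mk _))
  have hneg : ψ z₂ = -ψ z₁ := congrFun (hodd ⟨_, hmem z₁⟩ ⟨_, hmem z₂⟩ (cutPlane_neg A 1)) 0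
  have hzero : ∃ z, ψ z = 0 := by
    rcases le_total (ψ z₁) 0 with h | h
    · exact mem_range_of_exists_le_of_exists_ge hψc ⟨z₁, h⟩ ⟨z₂, by linarith⟩
    · exact mem_range_of_exists_le_of_exists_ge hψc ⟨z₂, by linarith⟩ ⟨z₁, h⟩
  obtain ⟨z, hz⟩ := hzero
  exact hφ0 ⟨_, hmem z⟩ (funext fun j => by rw [Subsingleton.elim j 0]; exact hz)

/-- Vectors that are constant on `A` and on its complement have only `∅`, `A`, `V \ A`, `V` as
level sets. -/
theorem upperLevel_cutPlane (A : Finset V) (z : ℂ) (t : ℝ) :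
    let S := upperLevel (z.re • indVec A + z.im • indVec Aᶜ) t
    S = ∅ ∨ S = A ∨ S = Aᶜ ∨ S = Finset.univ := by
  have hmem : ∀ i, i ∈ upperLevel (z.re • indVec A + z.im • indVec Aᶜ) t ↔
      (i ∈ A ∧ t < z.re) ∨ (i ∉ A ∧ t < z.im) := by
    intro i
    rw [mem_upperLevel]
    by_cases hi : i ∈ A
    · simp [cutPlane_apply_of_mem hi, hi]
    · simp [cutPlane_apply_of_notMem hi, hi]
  by_cases h1 : t < z.re <;> by_cases h2 : t < z.im <;> simp only [h1, h2] at hmem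
  · exact Or.inr (Or.inr (Or.inr (Finset.ext fun i => by rw [hmem i]; simp [em])))
  · exact Or.inr (Or.inl (Finset.ext fun i => by rw [hmem i]; simp))
  · exact Or.inr (Or.inr (Or.inl (Finset.ext fun i => by rw [hmem i]; simp)))
  · exact Or.inl (Finset.ext fun i => by rw [hmem i]; simp)

theorem isMinmaxEigenvalue_two (hf0 : f ∅ = 0) (hsymm : ∀ A, f A = f Aᶜ) (hf : ∀ A, 0 ≤ f A)
    (hg0 : g ∅ = 0) (hpos : ∀ A : Finset V, A ≠ ∅ → 0 < g A) (hg : Monotone g) {c : ℝ}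
    (hc : IsLeast (cutRatios f g) c) :
    IsMinmaxEigenvalue (pairLovaszExt (pairSum f)) (pairLovaszExt (pairSum g)) 2 c := by
  have hcut := mul_min_le_of_isLeast hf0 hsymm hg0 hpos hc
  have hc0 := isoperimetric_nonneg hf hpos hc
  constructor
  · rintro s ⟨S, -, hS0, -, hgen, hs⟩
    obtain ⟨x, hx, hbal⟩ := exists_balanced_of_genusAtLeast hg hgen
    have hxne : x ≠ 0 := fun h => hS0 (h ▸ hx)
    refine le_trans ?_ (hs.1 ⟨x, hx, rfl⟩)
    rw [le_div_iff₀ (pairLovaszExt_pairSum_pos hg0 hpos hxne)]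
    exact mul_pairLovaszExt_le fun t ht => hbal.mul_pairSum_le hg hcut ht
  · intro b hb
    obtain ⟨A, h1, h2, hle, hfA⟩ := exists_minimizer hsymm hpos hc
    have h0S : (0 : V → ℝ) ∉ cutCircle A := by
      rintro ⟨z, hz, h⟩
      obtain ⟨i, hi⟩ := Finset.nonempty_iff_ne_empty.2 h1
      obtain ⟨j, hj⟩ : ∃ j, j ∉ A := by
        by_contra! hall
        exact h2 (Finset.eq_univ_iff_forall.2 hall)
      have k1 := congrFun h i
      have k2 := congrFun h j
      simp only [cutPlane_apply_of_mem hi, cutPlane_apply_of_notMem hj, Pi.zero_apply] at k1 k2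
      have : z = 0 := Complex.ext k1 k2
      simp [this] at hz
    have hle4 : ∀ S, S = ∅ ∨ S = A ∨ S = Aᶜ ∨ S = Finset.univ → f S ≤ c * g S := by
      rintro S (rfl | rfl | rfl | rfl)
      · rw [hf0, hg0, mul_zero]
      · exact hfA.le
      · rw [← hsymm, hfA]
        exact mul_le_mul_of_nonneg_left hle hc0
      · rw [hsymm, Finset.compl_univ, hf0]
        exact mul_nonneg hc0 (hg0 ▸ hg (Finset.empty_subset _))
    have hub : ∀ r ∈ (fun x => pairLovaszExt (pairSum f) x / pairLovaszExt (pairSum g) x) ''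
        cutCircle A, r ≤ c := by
      rintro _ ⟨_, ⟨z, hz, rfl⟩, rfl⟩
      have hxne : z.re • indVec A + z.im • indVec Aᶜ ≠ 0 := fun h => h0S ⟨z, hz, h⟩
      have hG := pairLovaszExt_pairSum_pos hg0 hpos hxne
      refine (div_le_iff₀ hG).2 ?_
      have h3 : ∀ t, 0 ≤ t →
          -c * pairSum g (levelPair (z.re • indVec A + z.im • indVec Aᶜ) t) ≤
            (fun p => -pairSum f p) (levelPair (z.re • indVec A + z.im • indVec Aᶜ) t) := by
        intro t ht
        have k1 := hle4 _ (upperLevel_cutPlane A z t)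
        have k2 := hle4 _ (upperLevel_cutPlane A (-z) t)
        rw [cutPlane_neg] at k2
        simp only [pairSum, levelPair, max_eq_left ht]
        linarith
      have h4 := mul_pairLovaszExt_le (f := fun p => -pairSum f p) (g := pairSum g) h3
      have h5 : ∀ x, pairLovaszExt (fun p => -pairSum f p) x = -pairLovaszExt (pairSum f) x :=
        fun x => intervalIntegral.integral_neg
      rw [h5] at h4
      linarith
    have hne : (cutCircle A).Nonempty := ⟨_, 1, by simp, rfl⟩
    have hlub := isLUB_csSup (hne.image _) ⟨c, hub⟩
    refine (hb ⟨cutCircle A, ?_, h0S, ?_, genusAtLeast_cutCircle A, hlub⟩).trans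
      (csSup_le (hne.image _) hub)
    · exact (isCompact_sphere 0 1).image (continuous_cutPlane A)
    · rintro _ ⟨z, hz, rfl⟩
      exact ⟨-z, by simpa using hz, cutPlane_neg A z⟩

end Isoperimetric

/-! ### The eigenvalue theorem -/

theorem mainTheorem5 {V : Type*} [Fintype V] [DecidableEq V] [Nonempty V] :
    -- original Lovász extension
    (∀ f g : Finset V → ℝ,
      (∀ lam : ℝ, IsEigenvalue (lovaszExt f) (lovaszExt g) lam →
        (∃ A : Finset V, A ≠ ∅ ∧ f A = lam * g A ∧
          IsEigenpair (lovaszExt f) (lovaszExt g) lam (indVec A)) ∧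
        (∀ a b : ℝ, a ≠ b → ∃ x : V → ℝ, (∀ i, x i = a ∨ x i = b) ∧
          IsEigenpair (lovaszExt f) (lovaszExt g) lam x) ∧
        (g Finset.univ ≠ 0 → lam = f Finset.univ / g Finset.univ)) ∧
      (g Finset.univ = 0 → (∃ lam : ℝ, IsEigenvalue (lovaszExt f) (lovaszExt g) lam) →
        f Finset.univ = 0)) ∧
    (∀ k : ℕ, ∃ (n : ℕ) (f g : Finset (Fin n) → ℝ), f Finset.univ = 0 ∧ g Finset.univ = 0 ∧
      (∀ A : Finset (Fin n), A ≠ ∅ → A ≠ Finset.univ → 0 < g A) ∧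
      (k : ℕ∞) ≤ {lam : ℝ | ∃ x : Fin n → ℝ, (∃ i j, x i ≠ x j) ∧
        IsEigenpair (lovaszExt f) (lovaszExt g) lam x}.encard) ∧
    -- disjoint-pair Lovász extension
    (∀ (f g : DisjointPair V → ℝ) (lam : ℝ),
      IsEigenvalue (pairLovaszExt f) (pairLovaszExt g) lam →
        (∃ p : DisjointPair V, p ≠ emptyPair ∧ f p = lam * g p ∧
          IsEigenpair (pairLovaszExt f) (pairLovaszExt g) lam (pairVec p)) ∧
        (SplitsEvenly f → SplitsEvenly g →
          ∃ A : Finset V, f (pairLeft A) = lam * g (pairLeft A) ∧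
            IsEigenpair (pairLovaszExt f) (pairLovaszExt g) lam (pairVec (pairLeft A)))) ∧
    (∀ (f g : DisjointPair V → ℝ) (c : ℝ), c ≠ 0 →
      (∀ p : DisjointPair V, p ≠ emptyPair → 0 ≤ f p) →
      (∀ p : DisjointPair V, p ≠ emptyPair → g p = c) →
      ∀ A : Finset V, ∃ lam : ℝ,
        IsEigenpair (pairLovaszExt f) (pairLovaszExt g) lam (pairVec (pairLeft A))) ∧
    -- the second eigenvalue
    (Nontrivial V → ∀ f g : Finset V → ℝ,
      f ∅ = 0 → (∀ A : Finset V, f A = f Aᶜ) →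
      g ∅ = 0 → (∀ A : Finset V, A ≠ ∅ → 0 < g A) → Monotone g → IsSubmodular g →
      (∀ x : V → ℝ, x ≠ 0 → ∑ i, x i = 0 → ∃ m : ℝ, 0 < m ∧
        IsLeast (Set.range fun t : ℝ => pairLovaszExt (pairSum g) (fun i => x i - t)) m) ∧
      ∃ c : ℝ,
        IsLeast {r : ℝ | ∃ A : Finset V, A ≠ ∅ ∧ A ≠ Finset.univ ∧
          r = f A / min (g A) (g Aᶜ)} c ∧
        IsLeast {r : ℝ | ∃ (x : V → ℝ) (m : ℝ), x ≠ 0 ∧ ∑ i, x i = 0 ∧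
          IsLeast (Set.range fun t : ℝ => pairLovaszExt (pairSum g) (fun i => x i - t)) m ∧
          r = pairLovaszExt (pairSum f) x / m} c ∧
        ((∀ A : Finset V, 0 ≤ f A) →
          IsLeast {r : ℝ | ∃ p : DisjointPair V, p.1.1 ≠ ∅ ∧ p.1.2 ≠ ∅ ∧
            r = max (f p.1.1 / g p.1.1) (f p.1.2 / g p.1.2)} c ∧
          IsKthEigenvalue (pairLovaszExt (pairSum f)) (pairLovaszExt (pairSum g)) 2 c ∧
          IsKthSetEigenvalue (pairSum f) (pairSum g) 2 c ∧
          IsMinmaxEigenvalue (pairLovaszExt (pairSum f)) (pairLovaszExt (pairSum g)) 2 c)) := by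
  refine ⟨fun f g => ⟨fun lam h => ?_, ?_⟩, exists_many_eigenvalues, fun f g lam h => ?_,
    fun f g c hc hf hg A => exists_isEigenpair_pairLeft hc hf hg A, ?_⟩
  · obtain ⟨x, hx⟩ := h
    have hconst : ∀ a : ℝ, a ≠ 0 →
        IsEigenpair (lovaszExt f) (lovaszExt g) lam fun _ => a := fun a ha =>
      hx.of_isLinearAlong (fun h => ha (congrFun h (Classical.arbitrary V)))
        (posHom_lovaszExt f) (posHom_lovaszExt g) (isLinearAlong_lovaszExt_const f x a)
        (isLinearAlong_lovaszExt_const g x a)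
    have hval := hx.dotProduct_eq (isLinearAlong_lovaszExt_const f x 1)
      (isLinearAlong_lovaszExt_const g x 1)
    rw [one_mul, one_mul] at hval
    have hone : indVec (Finset.univ : Finset V) = fun _ => 1 := by ext i; simp [indVec]
    refine ⟨⟨Finset.univ, Finset.univ_nonempty.ne_empty, hval, ?_⟩, fun a b hab => ?_,
      fun hg => by rw [hval, mul_div_cancel_right₀ _ hg]⟩
    · rw [hone]
      exact hconst 1 one_ne_zero
    · by_cases ha : a = 0
      · exact ⟨fun _ => b, fun _ => Or.inr rfl, hconst b fun hb => hab (ha.trans hb.symm)⟩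
      · exact ⟨fun _ => a, fun _ => Or.inl rfl, hconst a ha⟩
  · rintro hg ⟨lam, x, hx⟩
    have hval := hx.dotProduct_eq (isLinearAlong_lovaszExt_const f x 1)
      (isLinearAlong_lovaszExt_const g x 1)
    rwa [one_mul, one_mul, hg, mul_zero] at hval
  · obtain ⟨x, hx⟩ := h
    have hpos : 0 < ‖x‖ := norm_pos_iff.2 hx.1
    exact ⟨⟨_, levelPair_ne_emptyPair le_rfl hpos, hx.at_levelPair le_rfl hpos⟩,
      hx.exists_pairLeft⟩
  · intro _ f g hf0 hsymm hg0 hpos hg hsub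
    obtain ⟨c, hc⟩ := exists_isLeast_cutRatios f g
    exact ⟨fun x hx hsum => exists_isLeast_sub_const hg0 hpos hg hx hsum, c, hc,
      isLeast_quotient hf0 hsymm hg0 hpos hg hc, fun hf =>
        ⟨isLeast_max_ratio hf0 hsymm hf hg0 hpos hg hc,
          isKthEigenvalue_two hf0 hsymm hf hg0 hpos hg hsub hc,
          isKthSetEigenvalue_two hf0 hsymm hf hg0 hpos hg hsub hc,
          isMinmaxEigenvalue_two hf0 hsymm hf hg0 hpos hg hc⟩⟩
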